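/- Let $M$ be a smooth compact manifold, possibly with boundary or corners, and let $\mu_0$ be a smooth positive density on $M$ with $\int_M\mu_0=1$. Let $\langle f,g\rangle=\int_M fg\,\mu_0$ and $\|f\|^2=\langle f,f\rangle$ be the $L^2(\mu_0)$ inner product and norm, and let $L^2(M,\mathbb R)=L^2(M,\mu_0)$. Let $C_1,C_2:(0,\infty)\to\mathbb R$ be smooth with $C_1(m)>0$ and $C_2(m)>-\frac1m C_1(m)$ for all $m>0$. On the space $\mathrm{Dens}_+(M)$ of smooth positive densities consider the Riemannian metric $$G_\mu(\alpha,\beta)=C_1(\mu(M))\int_M\frac{\alpha}{\mu}\frac{\beta}{\mu}\,\mu+C_2(\mu(M))\int_M\alpha\cdot\int_M\beta ,$$ and on $L^2(M,\mathbb R)\setminus\{0\}$ and $C^\infty(M,\mathbb R)\setminus\{0\}$ the metric $$\tilde G_f(h,k)=4C_1(\|f\|^2)\langle h,k\rangle+4C_2(\|f\|^2)\langle f,h\rangle\langle f,k\rangle .$$ For $r>0$ let $W(r)=\int_1^r\sqrt{g_2(\rho)}\,d\rho$ with $g_2(\rho)=4\big(C_1(\rho^2)+C_2(\rho^2)\rho^2\big)$,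 and let $W_-=\lim_{r\to0+}W(r)$ and $W_+=\lim_{r\to\infty}W(r)$. Assume $(W_-,W_+)=(-\infty,+\infty)$. Then: 1. $(L^2(M,\mathbb R)\setminus\{0\},\tilde G)$ is metrically complete: its geodesic distance (the infimum of the lengths of connecting $C^1$ curves, $+\infty$ if there are none) separates points, and every Cauchy sequence for it converges in $L^2(M,\mathbb R)\setminus\{0\}$. 2. $(L^2(M,\mathbb R)\setminus\{0\},\tilde G)$ is geodesically complete: for every initial point and initial velocity there is a geodesic defined on all of $\mathbb R$, and every geodesic on a nonempty open interval extends to a geodesic on $\mathbb R$. 3. $(C^\infty(M,\mathbb R)\setminus\{0\},\tilde G)$ is geodesically complete in the same sense, where the curves are smooth curves in the Fréchet space $C^\infty(M,\mathbb R)$ and initial points and velocities lie in $C^\infty(M,\mathbb R)$. 4. Let $S$ be the unit sphere of $L^2(M,\mathbb R)$, let $r(s)$ be the inverse function of $W:(0,\infty)\to\mathbb R$, and let $a(s)=4C_1(r(s)^2)\,r(s)^2$. The map $f\mapsto\big(W(\|f\|),f/\|f\|\big)$ is a diffeomorphism of $L^2(M,\mathbb R)\setminus\{0\}$ onto $\mathbb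 R\times S$, with inverse $(s,\varphi)\mapsto r(s)\varphi$, and it is an isometry from $\tilde G$ to $\bar G=a(s)\langle d\varphi,d\varphi\rangle+ds^2$. 5. The map $f\mapsto f^2\mu_0$ is a bijection of $C^\infty(M,\mathbb R_{>0})\subset C^\infty(M,\mathbb R)\setminus\{0\}$ onto $\mathrm{Dens}_+(M)$ which pulls back $G$ to $\tilde G$, that is, $G_{f^2\mu_0}(2fh\mu_0,2fk\mu_0)=\tilde G_f(h,k)$ for $f\in C^\infty(M,\mathbb R_{>0})$ and $h,k\in C^\infty(M,\mathbb R)$. In this sense the spaces in 1-3 are a (partial) completion of $(\mathrm{Dens}_+(M),G)$. -/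

import Mathlib

open scoped Manifold ContDiff Topology

noncomputable section

namespace DensMetric

open MeasureTheory Set Filter

/-! ### Smooth positive densities and the general invariant metric on them -/

/-- The Borel measure `μ` on the manifold `M` is (integration against) a smooth positive density:
in each of the charts covering `M` it is a smooth positive multiple of Lebesgue measure, with
smoothness up to the boundary and the corners. -/
def IsSmoothPosDensity {m : ℕ} {H : Type*} [TopologicalSpace H]
    (I : ModelWithCorners ℝ (EuclideanSpace ℝ (Fin m)) H)
    {M : Type*} [TopologicalSpace M] [ChartedSpace H M] [MeasurableSpace M]
    (μ : Measure M) : Prop :=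
  ∀ x : M, ∃ ρ : EuclideanSpace ℝ (Fin m) → ℝ,
    ContDiffOn ℝ ∞ ρ (extChartAt I x).target ∧
    (∀ y ∈ (extChartAt I x).target, 0 < ρ y) ∧
    (μ.restrict (extChartAt I x).source).map (extChartAt I x) =
      (volume.restrict (extChartAt I x).target).withDensity (fun y => ENNReal.ofReal (ρ y))

/-- The metric `G_μ(α, β) = C₁(μ(M)) ∫ (α/μ)(β/μ) μ + C₂(μ(M)) ∫ α ∫ β` at the positive
density `μ`; tangent vectors `α`, `β` are densities, regarded as signed measures, and the
quotients are Radon-Nikodym derivatives. -/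
def densMetric {M : Type*} [MeasurableSpace M] (C₁ C₂ : ℝ → ℝ) (μ : Measure M)
    (α β : SignedMeasure M) : ℝ :=
  C₁ (μ.real univ) * ∫ x, α.rnDeriv μ x * β.rnDeriv μ x ∂μ
    + C₂ (μ.real univ) * (α univ * β univ)

/-- The map `R⁻¹ : f ↦ f² μ₀`. -/
def sqDens {M : Type*} [MeasurableSpace M] (μ₀ : Measure M) (f : M → ℝ) : Measure M :=
  μ₀.withDensity (fun x => ENNReal.ofReal (f x ^ 2))

/-- The tangent map of `R⁻¹` at `f`, sending `h` to `2 f h μ₀`. -/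
def sqDensTangent {M : Type*} [MeasurableSpace M] (μ₀ : Measure M) (f h : M → ℝ) :
    SignedMeasure M :=
  μ₀.withDensityᵥ (fun x => 2 * f x * h x)

/-! ### The square-root metric -/

/-- `G̃_f(h, k) = 4 C₁(‖f‖²) ⟨h, k⟩ + 4 C₂(‖f‖²) ⟨f, h⟩ ⟨f, k⟩` on a vector space with
inner product `B`. -/
def rootMetric {V : Type*} (C₁ C₂ : ℝ → ℝ) (B : V → V → ℝ) (f h k : V) : ℝ :=
  4 * C₁ (B f f) * B h k + 4 * C₂ (B f f) * (B f h * B f k)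

/-- `G̃` on `L²(M, ℝ)`. -/
def rootMetricL2 {M : Type*} [MeasurableSpace M] (C₁ C₂ : ℝ → ℝ) (μ₀ : Measure M) :
    Lp ℝ 2 μ₀ → Lp ℝ 2 μ₀ → Lp ℝ 2 μ₀ → ℝ :=
  rootMetric C₁ C₂ (fun f g => inner ℝ f g)

/-- `G̃` on `C^∞(M, ℝ)`, with the `L²(μ₀)` inner product. -/
def rootMetricSmooth {m : ℕ} {H : Type*} [TopologicalSpace H]
    (I : ModelWithCorners ℝ (EuclideanSpace ℝ (Fin m)) H)
    {M : Type*} [TopologicalSpace M] [ChartedSpace H M] [MeasurableSpace M]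
    (C₁ C₂ : ℝ → ℝ) (μ₀ : Measure M) :
    C^∞⟮I, M; 𝓘(ℝ, ℝ), ℝ⟯ → C^∞⟮I, M; 𝓘(ℝ, ℝ), ℝ⟯ → C^∞⟮I, M; 𝓘(ℝ, ℝ), ℝ⟯ → ℝ :=
  rootMetric C₁ C₂ (fun f g => ∫ x, f x * g x ∂μ₀)

/-! ### Polar coordinates -/

/-- `g₂(r) = 4 (C₁(r²) + C₂(r²) r²)`. -/
def g₂ (C₁ C₂ : ℝ → ℝ) (r : ℝ) : ℝ := 4 * (C₁ (r ^ 2) + C₂ (r ^ 2) * r ^ 2)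

/-- `W(r) = ∫₁^r √(g₂(ρ)) dρ`, used for `r > 0`. -/
def W (C₁ C₂ : ℝ → ℝ) (r : ℝ) : ℝ := ∫ ρ in (1 : ℝ)..r, √(g₂ C₁ C₂ ρ)

/-- The inverse `r(s)` of `W : (0, ∞) → ℝ`. -/
def radius (C₁ C₂ : ℝ → ℝ) : ℝ → ℝ := Function.invFunOn (W C₁ C₂) (Ioi 0)

/-- `a(s) = 4 C₁(r(s)²) r(s)²`. -/
def warp (C₁ C₂ : ℝ → ℝ) (s : ℝ) : ℝ :=
  4 * C₁ (radius C₁ C₂ s ^ 2) * radius C₁ C₂ s ^ 2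

/-- The metric `Ḡ = a(s) ⟨dφ, dφ⟩ + ds²` at the point `(s, φ)` of `ℝ × S`, on tangent vectors of
`ℝ × S ⊆ ℝ × E`, where `S` is the unit sphere. -/
def polarMetric {E : Type*} [NormedAddCommGroup E] [InnerProductSpace ℝ E]
    (C₁ C₂ : ℝ → ℝ) (p u v : ℝ × E) : ℝ :=
  warp C₁ C₂ p.1 * inner ℝ u.2 v.2 + u.1 * v.1

/-- The map `(W × Id) ∘ Φ : f ↦ (W(‖f‖), f / ‖f‖)`. -/
def polar {E : Type*} [NormedAddCommGroup E] [InnerProductSpace ℝ E]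
    (C₁ C₂ : ℝ → ℝ) (f : E) : ℝ × E :=
  (W C₁ C₂ ‖f‖, ‖f‖⁻¹ • f)

/-- `polar` is a diffeomorphism of `E ∖ {0}` onto `ℝ × S` with inverse `(s, φ) ↦ r(s) φ`, and an
isometry from the metric `G` to the metric `Ḡ`. (A map into `ℝ × S` is smooth when it is smooth
into `ℝ × E`, and a map on `ℝ × S` is smooth when it is the restriction of a smooth map.) -/
structure PolarIsometricDiffeo {E : Type*} [NormedAddCommGroup E] [InnerProductSpace ℝ E]
    (C₁ C₂ : ℝ → ℝ) (G : E → E → E → ℝ) : Prop where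
  bijOn : BijOn (polar C₁ C₂) ({0}ᶜ : Set E) (univ ×ˢ Metric.sphere (0 : E) 1)
  smooth : ContDiffOn ℝ ∞ (polar C₁ C₂) ({0}ᶜ : Set E)
  smooth_inverse : ContDiff ℝ ∞ (fun p : ℝ × E => radius C₁ C₂ p.1 • p.2)
  left_inverse : ∀ f : E, f ≠ 0 → radius C₁ C₂ (polar C₁ C₂ f).1 • (polar C₁ C₂ f).2 = f
  isometry : ∀ f : E, f ≠ 0 → ∀ h k : E,
    polarMetric C₁ C₂ (polar C₁ C₂ f) (fderiv ℝ (polar C₁ C₂) f h)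
      (fderiv ℝ (polar C₁ C₂) f k) = G f h k

/-! ### Geodesic distance and metric completeness on `E ∖ {0}` -/

/-- Length of a `C¹` curve defined on `[0, 1]`. -/
def curveLength {E : Type*} [NormedAddCommGroup E] [NormedSpace ℝ E]
    (G : E → E → E → ℝ) (c : ℝ → E) : ENNReal :=
  ∫⁻ t in Icc (0 : ℝ) 1, ENNReal.ofReal
    √(G (c t) (derivWithin c (Icc 0 1) t) (derivWithin c (Icc 0 1) t))

/-- Geodesic distance on `E ∖ {0}`: the infimum of the lengths of the `C¹` curves in `E ∖ {0}`
from `f` to `g` (it is `⊤` when there are none). -/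
def geodDist {E : Type*} [NormedAddCommGroup E] [NormedSpace ℝ E]
    (G : E → E → E → ℝ) (f g : E) : ENNReal :=
  ⨅ (c : ℝ → E) (_ : ContDiffOn ℝ 1 c (Icc 0 1)) (_ : ∀ t ∈ Icc (0 : ℝ) 1, c t ≠ 0)
    (_ : c 0 = f) (_ : c 1 = g), curveLength G c

/-- `(E ∖ {0}, G)` is metrically complete: the geodesic distance separates points, and each of its
Cauchy sequences converges in `E ∖ {0}`. -/
structure MetricallyComplete {E : Type*} [NormedAddCommGroup E] [NormedSpace ℝ E]
    (G : E → E → E → ℝ) : Prop where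
  eq_of_dist_eq_zero : ∀ f g : E, f ≠ 0 → g ≠ 0 → geodDist G f g = 0 → f = g
  complete : ∀ u : ℕ → E, (∀ n, u n ≠ 0) →
    (∀ ε : ENNReal, 0 < ε → ∃ N : ℕ, ∀ i ≥ N, ∀ j ≥ N, geodDist G (u i) (u j) < ε) →
    ∃ f : E, f ≠ 0 ∧ Tendsto (fun n => geodDist G (u n) f) atTop (𝓝 0)

/-! ### Geodesics and geodesic completeness -/

/-- The Christoffel symbol of the first kind `Γ_f(h, h; k) = (D_h G)_f(h, k) - ½ (D_k G)_f(h, h)`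
of a (weak) Riemannian metric `G` on an open subset of the vector space `V`. -/
def christoffel {V : Type*} [AddCommGroup V] [Module ℝ V]
    (G : V → V → V → ℝ) (f h k : V) : ℝ :=
  deriv (fun ε : ℝ => G (f + ε • h) h k) 0
    - 1 / 2 * deriv (fun ε : ℝ => G (f + ε • k) h h) 0

/-- The geodesic equation `∇_{∂ₜ} c_t = 0`, that is, the Euler-Lagrange equation of the energy
`½ ∫ G_c(c_t, c_t) dt`, for a curve with position `f`, velocity `v` and acceleration `b`. -/
def GeodesicEquation {V : Type*} [AddCommGroup V] [Module ℝ V]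
    (G : V → V → V → ℝ) (f v b : V) : Prop :=
  ∀ k : V, G f b k + christoffel G f v k = 0

/-- `c` is a geodesic of `(E ∖ {0}, G)` on the open interval `J`. -/
structure IsGeodesicOn {E : Type*} [NormedAddCommGroup E] [NormedSpace ℝ E]
    (G : E → E → E → ℝ) (J : Set ℝ) (c : ℝ → E) : Prop where
  smooth : ContDiffOn ℝ ∞ c J
  ne_zero : ∀ t ∈ J, c t ≠ 0
  equation : ∀ t ∈ J, GeodesicEquation G (c t) (deriv c t) (deriv (deriv c) t)

/-- `(E ∖ {0}, G)` is geodesically complete: geodesics with arbitrary initial position and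
velocity exist for all time, and every geodesic on an open interval extends to one on `ℝ`. -/
structure GeodesicallyComplete {E : Type*} [NormedAddCommGroup E] [NormedSpace ℝ E]
    (G : E → E → E → ℝ) : Prop where
  exists_geodesic : ∀ f h : E, f ≠ 0 →
    ∃ c : ℝ → E, IsGeodesicOn G univ c ∧ c 0 = f ∧ deriv c 0 = h
  extend : ∀ (J : Set ℝ) (c : ℝ → E), IsOpen J → J.OrdConnected → J.Nonempty →
    IsGeodesicOn G J c → ∃ c' : ℝ → E, IsGeodesicOn G univ c' ∧ EqOn c' c J

section Smooth

variable {m : ℕ} {H : Type*} [TopologicalSpace H]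
  (I : ModelWithCorners ℝ (EuclideanSpace ℝ (Fin m)) H)
  {M : Type*} [TopologicalSpace M] [ChartedSpace H M]

/-- `v` is the velocity of the curve `c` in `C^∞(M, ℝ)` at the time `t`. -/
def HasVelocity (c : ℝ → C^∞⟮I, M; 𝓘(ℝ, ℝ), ℝ⟯) (v : C^∞⟮I, M; 𝓘(ℝ, ℝ), ℝ⟯) (t : ℝ) : Prop :=
  ∀ x : M, HasDerivAt (fun s => c s x) (v x) t

/-- `c` is a geodesic of `(C^∞(M, ℝ) ∖ {0}, G)` on the open interval `J`. For compact `M`, a curve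
in the Fréchet space `C^∞(M, ℝ)` is smooth when `(t, x) ↦ c(t)(x)` is smooth. -/
structure IsSmoothGeodesicOn
    (G : C^∞⟮I, M; 𝓘(ℝ, ℝ), ℝ⟯ → C^∞⟮I, M; 𝓘(ℝ, ℝ), ℝ⟯ → C^∞⟮I, M; 𝓘(ℝ, ℝ), ℝ⟯ → ℝ)
    (J : Set ℝ) (c : ℝ → C^∞⟮I, M; 𝓘(ℝ, ℝ), ℝ⟯) : Prop where
  smooth : ContMDiffOn (𝓘(ℝ, ℝ).prod I) 𝓘(ℝ, ℝ) ∞ (fun p : ℝ × M => c p.1 p.2) (J ×ˢ univ)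
  ne_zero : ∀ t ∈ J, c t ≠ 0
  equation : ∃ v b : ℝ → C^∞⟮I, M; 𝓘(ℝ, ℝ), ℝ⟯,
    ∀ t ∈ J, HasVelocity I c (v t) t ∧ HasVelocity I v (b t) t ∧
      GeodesicEquation G (c t) (v t) (b t)

/-- Geodesic completeness of `(C^∞(M, ℝ) ∖ {0}, G)`. -/
structure SmoothGeodesicallyComplete
    (G : C^∞⟮I, M; 𝓘(ℝ, ℝ), ℝ⟯ → C^∞⟮I, M; 𝓘(ℝ, ℝ), ℝ⟯ → C^∞⟮I, M; 𝓘(ℝ, ℝ), ℝ⟯ → ℝ) :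
    Prop where
  exists_geodesic : ∀ f h : C^∞⟮I, M; 𝓘(ℝ, ℝ), ℝ⟯, f ≠ 0 →
    ∃ c : ℝ → C^∞⟮I, M; 𝓘(ℝ, ℝ), ℝ⟯,
      IsSmoothGeodesicOn I G univ c ∧ c 0 = f ∧ HasVelocity I c h 0
  extend : ∀ (J : Set ℝ) (c : ℝ → C^∞⟮I, M; 𝓘(ℝ, ℝ), ℝ⟯),
    IsOpen J → J.OrdConnected → J.Nonempty → IsSmoothGeodesicOn I G J c →
    ∃ c' : ℝ → C^∞⟮I, M; 𝓘(ℝ, ℝ), ℝ⟯, IsSmoothGeodesicOn I G univ c' ∧ EqOn c' c J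

/-- `(Dens₊(M), G)` is identified with the part `{f > 0}` of `(C^∞(M, ℝ) ∖ {0}, G̃)`: the map
`f ↦ f² μ₀` is a bijection of the positive smooth functions onto the smooth positive densities,
and it pulls back the metric `G` to `G̃`. -/
structure DensitiesEmbed [MeasurableSpace M] (C₁ C₂ : ℝ → ℝ) (μ₀ : Measure M) : Prop where
  bijOn : BijOn (fun f : C^∞⟮I, M; 𝓘(ℝ, ℝ), ℝ⟯ => sqDens μ₀ f)
    {f | ∀ x, 0 < f x} {μ | IsSmoothPosDensity I μ}
  isometry : ∀ f : C^∞⟮I, M; 𝓘(ℝ, ℝ), ℝ⟯, (∀ x, 0 < f x) → ∀ h k : C^∞⟮I, M; 𝓘(ℝ, ℝ), ℝ⟯,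
    densMetric C₁ C₂ (sqDens μ₀ f) (sqDensTangent μ₀ f h) (sqDensTangent μ₀ f k)
      = rootMetricSmooth I C₁ C₂ μ₀ f h k

end Smooth

end DensMetric

end

/-!
The metric `G̃` on `E ∖ {0}` only involves the inner product of `E`, so everything except the
identification with densities is proved for a general inner product space `E` and then applied to
`L²(μ₀)` and to `C^∞(M, ℝ)` with the (incomplete) `L²(μ₀)` norm.

*Radial coordinate.* Splitting a tangent vector at `f` into its radial and tangential parts
diagonalises `G̃`: the radial part has length `|∂ₜ W(‖f‖)|`, the tangential one is scaled by
`4 C₁(‖f‖²)` (`innerMetric_self_eq`). This gives the isometry with the warped product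
(`IsCompleteAdmissible.polarIsometricDiffeo`), and it shows that `W(‖·‖)` is 1-Lipschitz for the
geodesic distance. As the range of `W` is `ℝ`, sets on which `W(‖·‖)` is bounded are annuli away
from `0` and `∞`, and on annuli `G̃` and the inner product are comparable.

*Metric completeness* (`IsCompleteAdmissible.metricallyComplete`). A Cauchy sequence for the
geodesic distance, together with the short curves connecting its members, stays in an annulus;
there it is a Cauchy sequence for the norm, and the limit is a limit for the geodesic distance as well.

*Geodesics.* Since `G̃_f` is a rank-one perturbation of a multiple of the inner product, the weak
geodesic equation can be solved for the acceleration even in an incomplete space, and the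
acceleration is a combination of position and velocity
(`IsAdmissible.geodesicEquation_iff`). A geodesic therefore stays in the span of its initial data,
which reduces existence to a finite-dimensional ordinary differential equation; conservation of
energy bounds `W(‖f‖)` and the velocity on bounded time intervals, so solutions are global
(`IsCompleteAdmissible.exists_hasDerivAt_geodesicField`). Uniqueness holds in any inner product
space because the geodesic spray is smooth. For `C^∞(M, ℝ)` it remains to see that a jointly smooth
curve is differentiable in the `L²(μ₀)` norm (`hasDerivAt_smooth`), and that curves in a
finite-dimensional space of smooth functions are jointly smooth.

*Densities* (`densitiesEmbed`). Two smooth positive densities have a smooth positive ratio in each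
chart. The local square roots of the ratio agree on overlaps, because a smooth positive density
charges every nonempty open set, and they glue to the unique positive `f` with `μ = f² μ₀`.
-/

namespace DensMetric

open MeasureTheory Set Filter

/-! ### Autonomous ordinary differential equations -/

section ODE

variable {F : Type*} [NormedAddCommGroup F] [NormedSpace ℝ F]

/-- Solutions of an autonomous equation with smooth right-hand side are smooth. -/
theorem contDiffOn_of_hasDerivAt {X : F → F} {U : Set F} (hX : ContDiffOn ℝ ∞ X U)
    {u : ℝ → F} {J : Set ℝ} (hJ : IsOpen J)
    (hu : ∀ t ∈ J, u t ∈ U ∧ HasDerivAt u (X (u t)) t) : ContDiffOn ℝ ∞ u J := by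
  have hd : DifferentiableOn ℝ u J := fun t ht =>
    (hu t ht).2.differentiableAt.differentiableWithinAt
  rw [contDiffOn_infty]
  intro n
  induction n with
  | zero => simpa using hd.continuousOn
  | succ n ih =>
    have hXu : ContDiffOn ℝ n (fun t => X (u t)) J :=
      (hX.of_le (by exact_mod_cast le_top)).comp ih fun t ht => (hu t ht).1
    have : ContDiffOn ℝ ((n : WithTop ℕ∞) + 1) u J := by
      rw [contDiffOn_succ_iff_deriv_of_isOpen hJ]
      exact ⟨hd, by simp, hXu.congr fun t ht => (hu t ht).2.deriv⟩
    exact_mod_cast this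

/-- Uniqueness for a `C¹` vector field on an open set, on connected time sets and without
completeness of the space. -/
theorem eqOn_of_hasDerivAt {X : F → F} {U : Set F} (hU : IsOpen U) (hX : ContDiffOn ℝ 1 X U)
    {u w : ℝ → F} {J : Set ℝ} (hJo : IsOpen J) (hJ : IsPreconnected J)
    (hu : ∀ t ∈ J, u t ∈ U ∧ HasDerivAt u (X (u t)) t)
    (hw : ∀ t ∈ J, w t ∈ U ∧ HasDerivAt w (X (w t)) t)
    {t₀ : ℝ} (ht₀ : t₀ ∈ J) (h₀ : u t₀ = w t₀) : EqOn u w J := by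
  have hloc : ∀ t ∈ J, u t = w t → u =ᶠ[𝓝 t] w := by
    intro t ht h
    obtain ⟨K, s, hs, hK⟩ := (hX.contDiffAt (hU.mem_nhds (hu t ht).1)).exists_lipschitzOnWith
    refine ODE_solution_unique_of_eventually (v := fun _ => X) (s := fun _ => s)
      (.of_forall fun _ => hK) ?_ ?_ h
    · filter_upwards [hJo.mem_nhds ht, (hu t ht).2.continuousAt.eventually hs] with r hr hr'
      exact ⟨(hu r hr).2, hr'⟩
    · filter_upwards [hJo.mem_nhds ht, (hw t ht).2.continuousAt.eventually (h ▸ hs)] with r hr hr'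
      exact ⟨(hw r hr).2, hr'⟩
  have hsub : J ⊆ {t | u =ᶠ[𝓝 t] w} := by
    refine hJ.subset_of_closure_inter_subset isOpen_setOfPred_eventually_nhds
      ⟨t₀, ht₀, hloc t₀ ht₀ h₀⟩ ?_
    rintro t ⟨htc, htJ⟩
    refine hloc t htJ ?_
    have hne : (𝓝[{t | u =ᶠ[𝓝 t] w}] t).NeBot := mem_closure_iff_nhdsWithin_neBot.1 htc
    refine tendsto_nhds_unique_of_eventuallyEq
      ((hu t htJ).2.continuousAt.continuousWithinAt (s := {t | u =ᶠ[𝓝 t] w}))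
      ((hw t htJ).2.continuousAt.continuousWithinAt) ?_
    filter_upwards [self_mem_nhdsWithin] with r hr using hr.self_of_nhds
  exact fun t ht => (hsub ht).self_of_nhds

/-- A bounded, globally Lipschitz vector field has integral curves on arbitrarily long
intervals. -/
theorem exists_hasDerivAt_of_bounded_of_lipschitz [CompleteSpace F] {Y : F → F} {K L : NNReal}
    (hK : LipschitzWith K Y) (hL : ∀ x, ‖Y x‖ ≤ L) (u₀ : F) {T : ℝ} (hT : 0 < T) :
    ∃ u : ℝ → F, u 0 = u₀ ∧ ∀ t ∈ Ioo (-T) T, HasDerivAt u (Y (u t)) t := by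
  have h0 : (0 : ℝ) ∈ Icc (-T) T := ⟨by linarith, hT.le⟩
  have hPL : IsPicardLindelof (fun _ => Y) (⟨0, h0⟩ : Icc (-T) T) u₀ (L * T.toNNReal) 0 L K :=
    IsPicardLindelof.of_time_independent (fun x _ => hL x) hK.lipschitzOnWith
      (by simp [hT.le])
  obtain ⟨u, hu0, hu⟩ := hPL.exists_eq_forall_mem_Icc_hasDerivWithinAt₀
  exact ⟨u, hu0, fun t ht => (hu t (Ioo_subset_Icc_self ht)).hasDerivAt (Icc_mem_nhds ht.1 ht.2)⟩

/-- Global existence from an a priori bound: if, for each `T`, the integral curves on `(-T, T)`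
starting at `u₀` of all rescalings `χ • X` of the vector field `X` with `0 ≤ χ ≤ 1` stay in one
compact set, then `X` has an integral curve through `u₀` defined on `ℝ`. Allowing rescalings
makes it possible to pass to a compactly supported field without changing the trajectories. -/
theorem exists_hasDerivAt_of_forall_mem_compact [FiniteDimensional ℝ F] {X : F → F} {U : Set F}
    (hU : IsOpen U) (hX : ContDiffOn ℝ 1 X U) {u₀ : F} (hu₀ : u₀ ∈ U)
    (h : ∀ T > 0, ∃ K ⊆ U, IsCompact K ∧ ∀ χ : F → ℝ, (∀ x, χ x ∈ Icc (0 : ℝ) 1) →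
      ∀ u : ℝ → F, u 0 = u₀ →
      (∀ t ∈ Ioo (-T) T, u t ∈ U ∧ HasDerivAt u (χ (u t) • X (u t)) t) →
      ∀ t ∈ Ioo (-T) T, u t ∈ K) :
    ∃ u : ℝ → F, u 0 = u₀ ∧ ∀ t, u t ∈ U ∧ HasDerivAt u (X (u t)) t := by
  have key : ∀ T > 0, ∃ u : ℝ → F, u 0 = u₀ ∧
      ∀ t ∈ Ioo (-T) T, u t ∈ U ∧ HasDerivAt u (X (u t)) t := by
    intro T hT
    obtain ⟨K, hKU, hK, hcurve⟩ := h T hT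
    have : CompleteSpace F := FiniteDimensional.complete ℝ F
    have : ProperSpace F := FiniteDimensional.proper ℝ F
    obtain ⟨K', hK', hKK', hK'U⟩ := exists_compact_between hK hU hKU
    obtain ⟨χ, hχ1, hχ0, hχ⟩ := exists_contMDiffMap_one_nhds_of_subset_interior
      (n := (1 : ℕ∞)) (M := F) 𝓘(ℝ, F) hK.isClosed hKK'
    have hχc : ContDiff ℝ 1 χ := χ.contMDiff.contDiff
    have hsupp : tsupport χ ⊆ K' :=
      closure_minimal (fun x hx => by_contra fun hx' => hx (hχ0 x hx')) hK'.isClosed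
    set Y : F → F := fun x => χ x • X x with hY
    have hYc : ContDiff ℝ 1 Y := by
      refine contDiff_iff_contDiffAt.2 fun x => ?_
      by_cases hx : x ∈ U
      · exact hχc.contDiffAt.smul (hX.contDiffAt (hU.mem_nhds hx))
      · have hx' : x ∉ tsupport χ := fun hx' => hx (hK'U (hsupp hx'))
        refine (contDiffAt_const (c := (0 : F))).congr_of_eventuallyEq ?_
        filter_upwards [(isClosed_tsupport χ).isOpen_compl.mem_nhds hx'] with y hy
        simp [hY, image_eq_zero_of_notMem_tsupport hy]
    have hYs : HasCompactSupport Y :=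
      HasCompactSupport.intro hK' fun x hx => by simp [hY, hχ0 x hx]
    obtain ⟨C, hC⟩ := hYc.lipschitzWith_of_hasCompactSupport hYs one_ne_zero
    obtain ⟨L, hL⟩ := hYs.exists_bound_of_continuous hYc.continuous
    obtain ⟨u, hu0, hu⟩ := exists_hasDerivAt_of_bounded_of_lipschitz hC
      (L := L.toNNReal) (fun x => (hL x).trans (Real.le_coe_toNNReal L)) u₀ hT
    -- the curve cannot leave `U`, since the complement consists of zeros of `Y`
    have huU : ∀ t ∈ Ioo (-T) T, u t ∈ U := by
      intro t ht
      by_contra hne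
      have hY0 : Y (u t) = 0 := by
        simp [hY, hχ0 (u t) fun hx => hne (hK'U hx)]
      have := eqOn_of_hasDerivAt isOpen_univ hYc.contDiffOn isOpen_Ioo isPreconnected_Ioo
        (fun r hr => ⟨mem_univ _, hu r hr⟩) (w := fun _ => u t)
        (fun r _ => ⟨mem_univ _, by rw [hY0]; exact hasDerivAt_const _ _⟩) ht rfl
        (show (0 : ℝ) ∈ Ioo (-T) T from ⟨by linarith, hT⟩)
      exact hne (by rw [show u t = u 0 from this.symm, hu0]; exact hu₀)
    refine ⟨u, hu0, fun t ht => ⟨huU t ht, ?_⟩⟩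
    have hmem := hcurve χ hχ u hu0 (fun t ht => ⟨huU t ht, hu t ht⟩) t ht
    have h1 : χ (u t) = 1 := hχ1.self_of_nhdsSet _ hmem
    have := hu t ht
    simpa [hY, h1] using this
  choose! γ hγ0 hγ using key
  have hagree : ∀ T > 0, ∀ T' > 0, T ≤ T' → EqOn (γ T) (γ T') (Ioo (-T) T) := by
    intro T hT T' hT' hle
    refine eqOn_of_hasDerivAt hU hX isOpen_Ioo isPreconnected_Ioo (hγ T hT)
      (fun t ht => hγ T' hT' t ⟨by linarith [ht.1], by linarith [ht.2]⟩)
      (t₀ := 0) ⟨by linarith, hT⟩ ?_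
    rw [hγ0 T hT, hγ0 T' hT']
  have hpos : ∀ t : ℝ, 0 < |t| + 1 := fun t => by positivity
  have hmem : ∀ t : ℝ, t ∈ Ioo (-(|t| + 1)) (|t| + 1) := fun t => by
    rw [mem_Ioo, ← abs_lt]; linarith
  refine ⟨fun t => γ (|t| + 1) t, hγ0 _ (hpos 0), fun t => ?_⟩
  have ht := hγ _ (hpos t) t (hmem t)
  refine ⟨ht.1, ht.2.congr_of_eventuallyEq ?_⟩
  filter_upwards [Ioo_mem_nhds (hmem t).1 (hmem t).2] with r hr
  rcases le_total (|r| + 1) (|t| + 1) with hle | hle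
  · exact hagree _ (hpos r) _ (hpos t) hle (hmem r)
  · exact (hagree _ (hpos t) _ (hpos r) hle hr).symm

end ODE

/-! ### The radial coordinate -/

/-- The standing conditions on the coefficients of the metric: both are smooth on `(0, ∞)`,
`C₁ > 0` there, and `C₂(l) > -C₁(l) / l`, which says that the metric is positive in the radial
direction as well. -/
structure IsAdmissible (C₁ C₂ : ℝ → ℝ) : Prop where
  smooth₁ : ContDiffOn ℝ ∞ C₁ (Ioi 0)
  smooth₂ : ContDiffOn ℝ ∞ C₂ (Ioi 0)
  pos : ∀ l : ℝ, 0 < l → 0 < C₁ l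
  gt : ∀ l : ℝ, 0 < l → -(1 / l) * C₁ l < C₂ l

namespace IsAdmissible

variable {C₁ C₂ : ℝ → ℝ}

theorem add_mul_pos (h : IsAdmissible C₁ C₂) {l : ℝ} (hl : 0 < l) : 0 < C₁ l + C₂ l * l := by
  have h1 := mul_lt_mul_of_pos_right (h.gt l hl) hl
  have h2 : -(1 / l) * C₁ l * l = -C₁ l := by field_simp
  linarith

theorem g₂_pos (h : IsAdmissible C₁ C₂) {r : ℝ} (hr : 0 < r) : 0 < g₂ C₁ C₂ r :=
  mul_pos four_pos (h.add_mul_pos (pow_pos hr 2))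

theorem contDiffOn_g₂ (h : IsAdmissible C₁ C₂) : ContDiffOn ℝ ∞ (g₂ C₁ C₂) (Ioi 0) := by
  have hsq : ContDiffOn ℝ ∞ (fun r : ℝ => r ^ 2) (Ioi 0) := (contDiff_id.pow 2).contDiffOn
  have hm : MapsTo (fun r : ℝ => r ^ 2) (Ioi 0) (Ioi 0) := fun r hr =>
    pow_pos (show (0 : ℝ) < r from hr) 2
  exact contDiffOn_const.mul ((h.smooth₁.comp hsq hm).add ((h.smooth₂.comp hsq hm).mul hsq))

theorem contDiffOn_sqrt_g₂ (h : IsAdmissible C₁ C₂) :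
    ContDiffOn ℝ ∞ (fun r => √(g₂ C₁ C₂ r)) (Ioi 0) :=
  h.contDiffOn_g₂.sqrt fun _ hr => (h.g₂_pos hr).ne'

theorem hasDerivAt_W (h : IsAdmissible C₁ C₂) {r : ℝ} (hr : 0 < r) :
    HasDerivAt (W C₁ C₂) (√(g₂ C₁ C₂ r)) r := by
  have hc := h.contDiffOn_sqrt_g₂.continuousOn
  refine intervalIntegral.integral_hasDerivAt_right ?_
    (hc.stronglyMeasurableAtFilter isOpen_Ioi r hr) (hc.continuousAt (Ioi_mem_nhds hr))
  refine (hc.mono fun x hx => ?_).intervalIntegrable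
  exact lt_of_lt_of_le (lt_min one_pos hr) hx.1

theorem contDiffOn_W (h : IsAdmissible C₁ C₂) : ContDiffOn ℝ ∞ (W C₁ C₂) (Ioi 0) := by
  rw [contDiffOn_infty_iff_deriv_of_isOpen isOpen_Ioi]
  exact ⟨fun r hr => (h.hasDerivAt_W hr).differentiableAt.differentiableWithinAt,
    h.contDiffOn_sqrt_g₂.congr fun r hr => (h.hasDerivAt_W hr).deriv⟩

theorem strictMonoOn_W (h : IsAdmissible C₁ C₂) : StrictMonoOn (W C₁ C₂) (Ioi 0) := by
  refine strictMonoOn_of_deriv_pos (convex_Ioi 0) h.contDiffOn_W.continuousOn fun r hr => ?_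
  rw [interior_Ioi] at hr
  rw [(h.hasDerivAt_W hr).deriv]
  exact Real.sqrt_pos.2 (h.g₂_pos hr)

end IsAdmissible

/-- Admissible coefficients for which the range of `W` is all of `ℝ`: radial rays have infinite
length in both directions. -/
structure IsCompleteAdmissible (C₁ C₂ : ℝ → ℝ) : Prop extends IsAdmissible C₁ C₂ where
  tendsto_zero : Tendsto (W C₁ C₂) (𝓝[>] 0) atBot
  tendsto_atTop : Tendsto (W C₁ C₂) atTop atTop

namespace IsCompleteAdmissible

variable {C₁ C₂ : ℝ → ℝ}

theorem bijOn_W (h : IsCompleteAdmissible C₁ C₂) : BijOn (W C₁ C₂) (Ioi 0) univ := by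
  refine ⟨mapsTo_univ _ _, h.strictMonoOn_W.injOn, fun s _ => ?_⟩
  obtain ⟨a, ha, ha0⟩ :=
    ((h.tendsto_zero.eventually (eventually_lt_atBot s)).and self_mem_nhdsWithin).exists
  obtain ⟨b, hb, hb0⟩ :=
    ((h.tendsto_atTop.eventually (eventually_gt_atTop s)).and (eventually_gt_atTop 0)).exists
  exact isPreconnected_Ioi.intermediate_value₂ ha0 hb0 h.contDiffOn_W.continuousOn
    continuousOn_const ha.le hb.le

theorem radius_pos (h : IsCompleteAdmissible C₁ C₂) (s : ℝ) : 0 < radius C₁ C₂ s :=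
  Function.invFunOn_mem (h.bijOn_W.surjOn (mem_univ s))

theorem W_radius (h : IsCompleteAdmissible C₁ C₂) (s : ℝ) : W C₁ C₂ (radius C₁ C₂ s) = s :=
  Function.invFunOn_eq (h.bijOn_W.surjOn (mem_univ s))

theorem radius_W (h : IsCompleteAdmissible C₁ C₂) {r : ℝ} (hr : 0 < r) :
    radius C₁ C₂ (W C₁ C₂ r) = r :=
  h.bijOn_W.injOn (h.radius_pos _) hr (h.W_radius _)

theorem strictMono_radius (h : IsCompleteAdmissible C₁ C₂) : StrictMono (radius C₁ C₂) := by
  intro s t hst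
  rw [← h.strictMonoOn_W.lt_iff_lt (h.radius_pos s) (h.radius_pos t), h.W_radius, h.W_radius]
  exact hst

theorem continuous_radius (h : IsCompleteAdmissible C₁ C₂) : Continuous (radius C₁ C₂) := by
  refine continuous_iff_continuousAt.2 fun s =>
    continuousAt_of_monotoneOn_of_image_mem_nhds (s := univ)
      (h.strictMono_radius.monotone.monotoneOn _) univ_mem ?_
  refine mem_of_superset (Ioi_mem_nhds (h.radius_pos s)) fun r hr => ?_
  exact ⟨_, mem_univ _, h.radius_W hr⟩

theorem contDiff_radius (h : IsCompleteAdmissible C₁ C₂) : ContDiff ℝ ∞ (radius C₁ C₂) := by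
  rw [← contDiffOn_univ]
  have hne : ∀ r ∈ Ioi (0 : ℝ), √(g₂ C₁ C₂ r) ≠ 0 := fun r hr =>
    (Real.sqrt_pos.2 (h.g₂_pos hr)).ne'
  refine contDiffOn_of_hasDerivAt (U := Ioi 0) (h.contDiffOn_sqrt_g₂.inv hne) isOpen_univ
    fun s _ => ⟨h.radius_pos s, ?_⟩
  exact (h.hasDerivAt_W (h.radius_pos s)).of_local_left_inverse h.continuous_radius.continuousAt
    (hne _ (h.radius_pos s)) (.of_forall h.W_radius)

theorem warp_W (h : IsCompleteAdmissible C₁ C₂) {r : ℝ} (hr : 0 < r) :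
    warp C₁ C₂ (W C₁ C₂ r) = 4 * C₁ (r ^ 2) * r ^ 2 := by
  rw [warp, h.radius_W hr]

/-- A bound on `W` confines the radius to a compact interval. -/
theorem mem_Icc_radius (h : IsCompleteAdmissible C₁ C₂) {r a b : ℝ} (hr : 0 < r)
    (ha : a ≤ W C₁ C₂ r) (hb : W C₁ C₂ r ≤ b) : r ∈ Icc (radius C₁ C₂ a) (radius C₁ C₂ b) := by
  rw [← h.radius_W hr]
  exact ⟨h.strictMono_radius.monotone ha, h.strictMono_radius.monotone hb⟩

end IsCompleteAdmissible

/-! ### The isometry with the warped product -/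

section Polar

variable {E : Type*} [NormedAddCommGroup E] [InnerProductSpace ℝ E] {C₁ C₂ : ℝ → ℝ}

theorem IsAdmissible.fderiv_polar_apply (h : IsAdmissible C₁ C₂) {f : E} (hf : f ≠ 0) (k : E) :
    fderiv ℝ (polar C₁ C₂) f k =
      (√(g₂ C₁ C₂ ‖f‖) * (‖f‖⁻¹ * inner ℝ f k),
        ‖f‖⁻¹ • k - ((‖f‖ ^ 3)⁻¹ * inner ℝ f k) • f) := by
  have hf0 : 0 < ‖f‖ := norm_pos_iff.2 hf
  -- derivatives along the line `t ↦ f + t k` suffice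
  have hline : HasDerivAt (fun t : ℝ => f + t • k) k 0 := by
    simpa using ((hasDerivAt_id (0 : ℝ)).smul_const k).const_add f
  have hnorm : HasDerivAt (fun t : ℝ => ‖f + t • k‖) (‖f‖⁻¹ * inner ℝ f k) 0 := by
    have h2 := (hline.norm_sq).sqrt (by simpa using hf)
    simp only [Real.sqrt_sq (norm_nonneg _), zero_smul, add_zero] at h2
    convert! h2 using 1
    field_simp
  have hdiff : DifferentiableAt ℝ (polar C₁ C₂) f := by
    have hn : DifferentiableAt ℝ (fun f : E => ‖f‖) f := differentiableAt_id.norm ℝ hf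
    exact ((h.hasDerivAt_W hf0).differentiableAt.comp f hn).prodMk
      ((hn.inv hf0.ne').smul differentiableAt_id)
  have h1 : HasDerivAt (fun t : ℝ => polar C₁ C₂ (f + t • k)) (fderiv ℝ (polar C₁ C₂) f k) 0 := by
    have hd : HasFDerivAt (polar C₁ C₂) (fderiv ℝ (polar C₁ C₂) f) (f + (0 : ℝ) • k) := by
      simpa using hdiff.hasFDerivAt
    exact hd.comp_hasDerivAt 0 hline
  have h2 : HasDerivAt (fun t : ℝ => polar C₁ C₂ (f + t • k))
      (√(g₂ C₁ C₂ ‖f‖) * (‖f‖⁻¹ * inner ℝ f k),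
        ‖f‖⁻¹ • k + (-(‖f‖⁻¹ * inner ℝ f k) / ‖f‖ ^ 2) • f) 0 := by
    have hW : HasDerivAt (fun t : ℝ => W C₁ C₂ ‖f + t • k‖)
        (√(g₂ C₁ C₂ ‖f‖) * (‖f‖⁻¹ * inner ℝ f k)) 0 := by
      refine HasDerivAt.comp 0 (h₂ := W C₁ C₂) ?_ hnorm
      simpa using h.hasDerivAt_W hf0
    have hinv : HasDerivAt (fun t : ℝ => ‖f + t • k‖⁻¹ • (f + t • k))
        (‖f‖⁻¹ • k + (-(‖f‖⁻¹ * inner ℝ f k) / ‖f‖ ^ 2) • f) 0 := by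
      simpa using (hnorm.fun_inv (by simpa using hf)).fun_smul hline
    exact hW.prodMk hinv
  rw [h1.unique h2, sub_eq_add_neg, ← neg_smul]
  congr 3
  field_simp

theorem IsCompleteAdmissible.polarIsometricDiffeo (h : IsCompleteAdmissible C₁ C₂) :
    PolarIsometricDiffeo (E := E) C₁ C₂ (rootMetric C₁ C₂ fun f g => inner ℝ f g) where
  bijOn := by
    have hnorm : ∀ s : ℝ, ∀ φ ∈ Metric.sphere (0 : E) 1,
        ‖radius C₁ C₂ s • φ‖ = radius C₁ C₂ s := fun s φ hφ => by
      rw [norm_smul, mem_sphere_zero_iff_norm.1 hφ, mul_one,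
        Real.norm_of_nonneg (h.radius_pos s).le]
    have hleft : ∀ f : E, f ≠ 0 → radius C₁ C₂ (W C₁ C₂ ‖f‖) • (‖f‖⁻¹ • f) = f := fun f hf => by
      rw [h.radius_W (norm_pos_iff.2 hf), smul_inv_smul₀ (norm_ne_zero_iff.2 hf)]
    refine ⟨fun f hf => ⟨mem_univ _, ?_⟩, fun f hf g hg hfg => ?_, ?_⟩
    · simp [polar, norm_smul, inv_mul_cancel₀ (norm_ne_zero_iff.2 hf)]
    · rw [← hleft f hf, ← hleft g hg]
      simp only [polar, Prod.mk.injEq] at hfg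
      rw [hfg.1, hfg.2]
    · rintro ⟨s, φ⟩ ⟨-, hφ⟩
      have hφ' := hnorm s φ hφ
      refine ⟨radius C₁ C₂ s • φ, ?_, ?_⟩
      · exact norm_ne_zero_iff.1 (by rw [hφ']; exact (h.radius_pos s).ne')
      · rw [polar, hφ', h.W_radius, inv_smul_smul₀ (h.radius_pos s).ne']
  smooth := by
    have hn : ContDiffOn ℝ ∞ (fun f : E => ‖f‖) {0}ᶜ := fun f hf =>
      (contDiffAt_norm ℝ hf).contDiffWithinAt
    exact (h.contDiffOn_W.comp hn fun f hf => norm_pos_iff.2 hf).prodMk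
      ((hn.inv fun f hf => norm_ne_zero_iff.2 hf).smul contDiffOn_id)
  smooth_inverse := (h.contDiff_radius.comp contDiff_fst).smul contDiff_snd
  left_inverse f hf := by
    rw [polar, h.radius_W (norm_pos_iff.2 hf), smul_inv_smul₀ (norm_ne_zero_iff.2 hf)]
  isometry f hf k l := by
    have hf0 : 0 < ‖f‖ := norm_pos_iff.2 hf
    rw [h.fderiv_polar_apply hf, h.fderiv_polar_apply hf, polarMetric, rootMetric, polar,
      h.warp_W hf0]
    have hw : √(g₂ C₁ C₂ ‖f‖) ^ 2 = 4 * (C₁ (‖f‖ ^ 2) + C₂ (‖f‖ ^ 2) * ‖f‖ ^ 2) :=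
      Real.sq_sqrt (h.g₂_pos hf0).le
    generalize √(g₂ C₁ C₂ ‖f‖) = w at hw ⊢
    simp only [inner_sub_left, inner_sub_right, real_inner_smul_left, real_inner_smul_right,
      real_inner_self_eq_norm_sq, real_inner_comm f k]
    field_simp
    linear_combination (inner ℝ f k * inner ℝ f l) * hw

end Polar

/-! ### The geodesic equation as a second-order equation -/

section GeodesicField

variable (C₁ C₂ : ℝ → ℝ) {E : Type*} [NormedAddCommGroup E] [InnerProductSpace ℝ E]

/-- The metric `G̃` built from the inner product of `E`. -/
noncomputable abbrev innerMetric : E → E → E → ℝ := rootMetric C₁ C₂ fun f g => inner ℝ f g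

/-- For a geodesic with position `f`, velocity `v` and acceleration `b`, the inner product
`⟨f, b⟩` as a function of `q = ⟨f, f⟩`, `p = ⟨f, v⟩` and `e = ⟨v, v⟩`. -/
noncomputable def radialAcc (q p e : ℝ) : ℝ :=
  -(2 * deriv C₁ q * p ^ 2 + (deriv C₂ q * p ^ 2 + (C₂ q - deriv C₁ q) * e) * q) /
    (C₁ q + C₂ q * q)

/-- The coefficient of the position in the acceleration of a geodesic. -/
noncomputable def accPos (q p e : ℝ) : ℝ :=
  -(C₂ q * radialAcc C₁ C₂ q p e + (deriv C₂ q * p ^ 2 + (C₂ q - deriv C₁ q) * e)) / C₁ q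

/-- The coefficient of the velocity in the acceleration of a geodesic. -/
noncomputable def accVel (q p : ℝ) : ℝ := -(2 * deriv C₁ q * p) / C₁ q

/-- The acceleration of the geodesic with position `f` and velocity `v`. It lies in the span of
`f` and `v`. -/
noncomputable def geodesicAcc (f v : E) : E :=
  accPos C₁ C₂ (inner ℝ f f) (inner ℝ f v) (inner ℝ v v) • f +
    accVel C₁ (inner ℝ f f) (inner ℝ f v) • v

/-- The geodesic spray, as a vector field on `E × E`. -/
noncomputable def geodesicField (u : E × E) : E × E := (u.2, geodesicAcc C₁ C₂ u.1 u.2)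

variable {C₁ C₂}

namespace IsAdmissible

theorem accPos_mul_add (h : IsAdmissible C₁ C₂) {q : ℝ} (hq : 0 < q) (p e : ℝ) :
    accPos C₁ C₂ q p e * q + accVel C₁ q p * p = radialAcc C₁ C₂ q p e := by
  have h1 := (h.pos q hq).ne'
  have h2 := (h.add_mul_pos hq).ne'
  simp only [accPos, accVel, radialAcc]
  field_simp
  ring

theorem hasDerivAt₁ (h : IsAdmissible C₁ C₂) {q : ℝ} (hq : 0 < q) :
    HasDerivAt C₁ (deriv C₁ q) q :=
  ((h.smooth₁.contDiffAt (Ioi_mem_nhds hq)).differentiableAt (by simp)).hasDerivAt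

theorem hasDerivAt₂ (h : IsAdmissible C₁ C₂) {q : ℝ} (hq : 0 < q) :
    HasDerivAt C₂ (deriv C₂ q) q :=
  ((h.smooth₂.contDiffAt (Ioi_mem_nhds hq)).differentiableAt (by simp)).hasDerivAt

theorem hasDerivAt_innerMetric (h : IsAdmissible C₁ C₂) {f : E} (hf : f ≠ 0) (w k l : E) :
    HasDerivAt (fun ε : ℝ => innerMetric C₁ C₂ (f + ε • w) k l)
      (4 * (deriv C₁ (inner ℝ f f) * (2 * inner ℝ f w)) * inner ℝ k l +
        (4 * (deriv C₂ (inner ℝ f f) * (2 * inner ℝ f w)) * (inner ℝ f k * inner ℝ f l) +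
          4 * C₂ (inner ℝ f f) * (inner ℝ w k * inner ℝ f l + inner ℝ f k * inner ℝ w l))) 0 := by
  have hline : HasDerivAt (fun t : ℝ => f + t • w) w 0 := by
    simpa using ((hasDerivAt_id (0 : ℝ)).smul_const w).const_add f
  have hq : HasDerivAt (fun t : ℝ => inner ℝ (f + t • w) (f + t • w)) (2 * inner ℝ f w) 0 := by
    have := hline.inner ℝ hline
    simp only [zero_smul, add_zero, real_inner_comm f w] at this
    rwa [two_mul]
  have hin : ∀ k : E, HasDerivAt (fun t : ℝ => inner ℝ (f + t • w) k) (inner ℝ w k) 0 := fun k => by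
    simpa using hline.inner ℝ (hasDerivAt_const (0 : ℝ) k)
  have hpos : 0 < inner ℝ f f := real_inner_self_pos.2 hf
  have h1 : HasDerivAt (fun t : ℝ => C₁ (inner ℝ (f + t • w) (f + t • w)))
      (deriv C₁ (inner ℝ f f) * (2 * inner ℝ f w)) 0 := by
    refine HasDerivAt.comp (0 : ℝ) (h₂ := C₁) ?_ hq
    simpa using h.hasDerivAt₁ hpos
  have h2 : HasDerivAt (fun t : ℝ => C₂ (inner ℝ (f + t • w) (f + t • w)))
      (deriv C₂ (inner ℝ f f) * (2 * inner ℝ f w)) 0 := by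
    refine HasDerivAt.comp (0 : ℝ) (h₂ := C₂) ?_ hq
    simpa using h.hasDerivAt₂ hpos
  have := ((h1.const_mul 4).mul_const (inner ℝ k l)).fun_add
    ((h2.const_mul 4).fun_mul ((hin k).fun_mul (hin l)))
  simp only [zero_smul, add_zero] at this
  exact this

theorem christoffel_eq (h : IsAdmissible C₁ C₂) {f : E} (hf : f ≠ 0) (v k : E) :
    christoffel (innerMetric C₁ C₂) f v k =
      4 * (2 * deriv C₁ (inner ℝ f f) * inner ℝ f v * inner ℝ v k +
        (deriv C₂ (inner ℝ f f) * inner ℝ f v ^ 2 +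
          (C₂ (inner ℝ f f) - deriv C₁ (inner ℝ f f)) * inner ℝ v v) * inner ℝ f k) := by
  rw [christoffel, (h.hasDerivAt_innerMetric hf v v k).deriv,
    (h.hasDerivAt_innerMetric hf k v v).deriv, real_inner_comm v k]
  ring

/-- The weak geodesic equation is solvable for the acceleration, because `G̃` is a rank-one
perturbation of a multiple of the inner product. -/
theorem geodesicEquation_iff (h : IsAdmissible C₁ C₂) {f : E} (hf : f ≠ 0) (v b : E) :
    GeodesicEquation (innerMetric C₁ C₂) f v b ↔ b = geodesicAcc C₁ C₂ f v := by
  have hq : 0 < inner ℝ f f := real_inner_self_pos.2 hf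
  have h1 := (h.pos _ hq).ne'
  have h2 := (h.add_mul_pos hq).ne'
  -- the equation says that the following vector is orthogonal to everything
  have hweak : GeodesicEquation (innerMetric C₁ C₂) f v b ↔
      C₁ (inner ℝ f f) • b + (2 * deriv C₁ (inner ℝ f f) * inner ℝ f v) • v +
        (C₂ (inner ℝ f f) * inner ℝ f b + (deriv C₂ (inner ℝ f f) * inner ℝ f v ^ 2 +
          (C₂ (inner ℝ f f) - deriv C₁ (inner ℝ f f)) * inner ℝ v v)) • f = 0 := by
    rw [← inner_self_eq_zero (𝕜 := ℝ)]
    constructor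
    · intro hG
      refine (mul_eq_zero (a := (4 : ℝ)).1 ?_).resolve_left four_ne_zero
      refine Eq.trans ?_ (hG (C₁ (inner ℝ f f) • b +
        (2 * deriv C₁ (inner ℝ f f) * inner ℝ f v) • v +
        (C₂ (inner ℝ f f) * inner ℝ f b + (deriv C₂ (inner ℝ f f) * inner ℝ f v ^ 2 +
          (C₂ (inner ℝ f f) - deriv C₁ (inner ℝ f f)) * inner ℝ v v)) • f))
      rw [h.christoffel_eq hf]
      nth_rewrite 1 [inner_add_left, inner_add_left]
      simp only [rootMetric, real_inner_smul_left]
      ring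
    · intro hG k
      have hk := congrArg (fun w => 4 * inner ℝ w k) (inner_self_eq_zero.1 hG)
      simp only [inner_add_left, real_inner_smul_left, inner_zero_left, mul_zero] at hk
      rw [h.christoffel_eq hf, innerMetric, rootMetric, ← hk]
      ring
  have hp := h.accPos_mul_add hq (inner ℝ f v) (inner ℝ v v)
  rw [hweak]
  constructor
  · intro hw
    have hβ : inner ℝ f b = radialAcc C₁ C₂ (inner ℝ f f) (inner ℝ f v) (inner ℝ v v) := by
      have := congrArg (inner ℝ f) hw
      simp only [inner_add_right, real_inner_smul_right, inner_zero_right] at this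
      rw [radialAcc, eq_div_iff h2]
      linear_combination this
    rw [hβ] at hw
    have hb : C₁ (inner ℝ f f) • b = C₁ (inner ℝ f f) • geodesicAcc C₁ C₂ f v := by
      rw [geodesicAcc, smul_add, smul_smul, smul_smul, accPos, accVel, mul_div_cancel₀ _ h1,
        mul_div_cancel₀ _ h1, ← sub_eq_zero, ← hw]
      module
    exact smul_right_injective E h1 hb
  · rintro rfl
    have hβ : inner ℝ f (geodesicAcc C₁ C₂ f v) =
        radialAcc C₁ C₂ (inner ℝ f f) (inner ℝ f v) (inner ℝ v v) := by
      rw [← hp, geodesicAcc, inner_add_right, real_inner_smul_right, real_inner_smul_right]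
    rw [hβ, geodesicAcc, smul_add, smul_smul, smul_smul, accPos, accVel, mul_div_cancel₀ _ h1,
        mul_div_cancel₀ _ h1]
    module

theorem contDiffOn_geodesicField (h : IsAdmissible C₁ C₂) :
    ContDiffOn ℝ ∞ (geodesicField C₁ C₂ (E := E)) {u | u.1 ≠ 0} := by
  set U : Set (E × E) := {u | u.1 ≠ 0}
  have hq : ContDiffOn ℝ ∞ (fun u : E × E => (inner ℝ u.1 u.1 : ℝ)) U :=
    (contDiff_fst.inner ℝ contDiff_fst).contDiffOn
  have hp : ContDiffOn ℝ ∞ (fun u : E × E => (inner ℝ u.1 u.2 : ℝ)) U :=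
    (contDiff_fst.inner ℝ contDiff_snd).contDiffOn
  have he : ContDiffOn ℝ ∞ (fun u : E × E => (inner ℝ u.2 u.2 : ℝ)) U :=
    (contDiff_snd.inner ℝ contDiff_snd).contDiffOn
  have hpos : ∀ u ∈ U, 0 < (inner ℝ u.1 u.1 : ℝ) := fun u hu => real_inner_self_pos.2 hu
  have c1 := h.smooth₁.comp hq hpos
  have c2 := h.smooth₂.comp hq hpos
  have d1 := ((contDiffOn_infty_iff_deriv_of_isOpen isOpen_Ioi).1 h.smooth₁).2.comp hq hpos
  have d2 := ((contDiffOn_infty_iff_deriv_of_isOpen isOpen_Ioi).1 h.smooth₂).2.comp hq hpos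
  have n1 : ∀ u ∈ U, C₁ (inner ℝ u.1 u.1) ≠ 0 := fun u hu => (h.pos _ (hpos u hu)).ne'
  have n2 : ∀ u ∈ U, C₁ (inner ℝ u.1 u.1) + C₂ (inner ℝ u.1 u.1) * inner ℝ u.1 u.1 ≠ 0 :=
    fun u hu => (h.add_mul_pos (hpos u hu)).ne'
  simp only [Function.comp_def] at c1 c2 d1 d2
  have hforce := (d2.mul (hp.pow 2)).add ((c2.sub d1).mul he)
  have hrad := (((contDiffOn_const (c := (2 : ℝ))).mul d1).mul (hp.pow 2)).add (hforce.mul hq)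
    |>.neg.div (c1.add (c2.mul hq)) n2
  have hpos' := ((c2.mul hrad).add hforce).neg.div c1 n1
  have hvel := (((contDiffOn_const (c := (2 : ℝ))).mul d1).mul hp).neg.div c1 n1
  exact contDiffOn_snd.prodMk ((hpos'.smul contDiffOn_fst).add (hvel.smul contDiffOn_snd))

end IsAdmissible

end GeodesicField

/-! ### Bounds on the metric -/

section Bounds

variable {C₁ C₂ : ℝ → ℝ} {E : Type*} [NormedAddCommGroup E] [InnerProductSpace ℝ E]

/-- The splitting of `G̃` into its parts tangential to the sphere and radial. -/
theorem innerMetric_self_eq {f : E} (hf : f ≠ 0) (k : E) :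
    innerMetric C₁ C₂ f k k =
      4 * C₁ (‖f‖ ^ 2) * (‖k‖ ^ 2 - (‖f‖⁻¹ * inner ℝ f k) ^ 2) +
        g₂ C₁ C₂ ‖f‖ * (‖f‖⁻¹ * inner ℝ f k) ^ 2 := by
  have hf0 : ‖f‖ ≠ 0 := norm_ne_zero_iff.2 hf
  simp only [innerMetric, rootMetric, g₂, real_inner_self_eq_norm_sq]
  field_simp
  ring

theorem sq_inv_norm_mul_inner_le (f k : E) : (‖f‖⁻¹ * inner ℝ f k) ^ 2 ≤ ‖k‖ ^ 2 := by
  rcases eq_or_ne f 0 with rfl | hf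
  · simp
  have hf0 : 0 < ‖f‖ := norm_pos_iff.2 hf
  rw [sq_le_sq, abs_norm, abs_mul, abs_inv, abs_norm, inv_mul_le_iff₀ hf0]
  exact abs_real_inner_le_norm f k

namespace IsAdmissible

theorem sq_radial_le (h : IsAdmissible C₁ C₂) {f : E} (hf : f ≠ 0) (k : E) :
    (√(g₂ C₁ C₂ ‖f‖) * (‖f‖⁻¹ * inner ℝ f k)) ^ 2 ≤ innerMetric C₁ C₂ f k k := by
  have hf0 : 0 < ‖f‖ := norm_pos_iff.2 hf
  rw [innerMetric_self_eq hf, mul_pow, Real.sq_sqrt (h.g₂_pos hf0).le]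
  have := mul_nonneg (h.pos _ (pow_pos hf0 2)).le (sub_nonneg.2 (sq_inv_norm_mul_inner_le f k))
  linarith

/-- On a closed annulus the metric dominates a multiple of the norm. -/
theorem exists_mul_norm_le (h : IsAdmissible C₁ C₂) {a : ℝ} (b : ℝ) (ha : 0 < a) :
    ∃ m : ℝ, 0 < m ∧ ∀ f : E, ‖f‖ ∈ Icc a b → ∀ k : E,
      (m * ‖k‖) ^ 2 ≤ innerMetric C₁ C₂ f k k := by
  rcases (Icc a b).eq_empty_or_nonempty with hemp | hne
  · exact ⟨1, one_pos, fun f hf => by simp [hemp] at hf⟩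
  have hsub : Icc a b ⊆ Ioi 0 := fun r hr => ha.trans_le hr.1
  have hsq : ContinuousOn (fun r : ℝ => C₁ (r ^ 2)) (Icc a b) :=
    h.smooth₁.continuousOn.comp (continuous_pow 2).continuousOn fun r hr =>
      pow_pos (show (0 : ℝ) < r from hsub hr) 2
  obtain ⟨r, hr, hmin⟩ := isCompact_Icc.exists_isMinOn hne
    ((hsq.const_mul 4).inf (h.contDiffOn_g₂.continuousOn.mono hsub))
  set μ := min (4 * C₁ (r ^ 2)) (g₂ C₁ C₂ r) with hμ
  have hμ0 : 0 < μ := lt_min (mul_pos four_pos (h.pos _ (pow_pos (hsub hr) 2)))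
    (h.g₂_pos (hsub hr))
  refine ⟨√μ, Real.sqrt_pos.2 hμ0, fun f hf k => ?_⟩
  have hf0 : f ≠ 0 := norm_pos_iff.1 (hsub hf)
  have hle : μ ≤ min (4 * C₁ (‖f‖ ^ 2)) (g₂ C₁ C₂ ‖f‖) := hmin hf
  rw [innerMetric_self_eq hf0, mul_pow, Real.sq_sqrt hμ0.le]
  have h1 := mul_le_mul_of_nonneg_right (hle.trans (min_le_left _ _))
    (sub_nonneg.2 (sq_inv_norm_mul_inner_le f k))
  have h2 := mul_le_mul_of_nonneg_right (hle.trans (min_le_right _ _))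
    (sq_nonneg (‖f‖⁻¹ * inner ℝ f k))
  linarith

/-- On a closed annulus the metric is dominated by a multiple of the norm. -/
theorem exists_le_mul_norm (h : IsAdmissible C₁ C₂) {a : ℝ} (b : ℝ) (ha : 0 < a) :
    ∃ L : ℝ, 0 ≤ L ∧ ∀ f : E, ‖f‖ ∈ Icc a b → ∀ k : E,
      innerMetric C₁ C₂ f k k ≤ (L * ‖k‖) ^ 2 := by
  have hsub : Icc a b ⊆ Ioi 0 := fun r hr => ha.trans_le hr.1
  have hsq : ContinuousOn (fun r : ℝ => C₁ (r ^ 2)) (Icc a b) :=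
    h.smooth₁.continuousOn.comp (continuous_pow 2).continuousOn fun r hr =>
      pow_pos (show (0 : ℝ) < r from hsub hr) 2
  obtain ⟨B, hB⟩ := isCompact_Icc.bddAbove_image
    ((hsq.const_mul 4).add (h.contDiffOn_g₂.continuousOn.mono hsub))
  refine ⟨√B, Real.sqrt_nonneg _, fun f hf k => ?_⟩
  have hf' : 0 < ‖f‖ := hsub hf
  have hf0 : f ≠ 0 := norm_pos_iff.1 hf'
  have hle : 4 * C₁ (‖f‖ ^ 2) + g₂ C₁ C₂ ‖f‖ ≤ B := hB (mem_image_of_mem _ hf)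
  have hp1 := h.pos _ (pow_pos hf' 2)
  have hp2 := h.g₂_pos hf'
  rw [innerMetric_self_eq hf0, mul_pow (√B), Real.sq_sqrt (by linarith)]
  have h1 := mul_nonneg hp1.le (sq_nonneg (‖f‖⁻¹ * inner ℝ f k))
  have h2 := mul_le_mul_of_nonneg_left (sq_inv_norm_mul_inner_le f k) hp2.le
  have h3 := mul_le_mul_of_nonneg_right hle (sq_nonneg ‖k‖)
  linarith

end IsAdmissible

end Bounds

/-! ### Geodesics exist for all time and are unique -/

section Geodesics

variable {C₁ C₂ : ℝ → ℝ} {E : Type*} [NormedAddCommGroup E] [InnerProductSpace ℝ E]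

theorem isOpen_fst_ne_zero {E : Type*} [NormedAddCommGroup E] : IsOpen {u : E × E | u.1 ≠ 0} :=
  isOpen_ne_fun continuous_fst continuous_const

namespace IsAdmissible

/-- `W(‖f‖)` changes along a curve with the radial part of the speed. -/
theorem hasDerivWithinAt_W_norm (h : IsAdmissible C₁ C₂) {c : ℝ → E} {c' : E} {t : ℝ}
    {J : Set ℝ} (hc : HasDerivWithinAt c c' J t) (h0 : c t ≠ 0) :
    HasDerivWithinAt (fun t => W C₁ C₂ ‖c t‖)
      (√(g₂ C₁ C₂ ‖c t‖) * (‖c t‖⁻¹ * inner ℝ (c t) c')) J t := by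
  have hn : HasDerivWithinAt (fun t => ‖c t‖) (‖c t‖⁻¹ * inner ℝ (c t) c') J t := by
    have h2 := (hc.norm_sq).sqrt (by simpa using h0)
    simp only [Real.sqrt_sq (norm_nonneg _)] at h2
    convert! h2 using 1
    field_simp
  exact (h.hasDerivAt_W (norm_pos_iff.2 h0)).comp_hasDerivWithinAt t hn

/-- The energy is constant along the integral curves of all rescalings of the geodesic spray. -/
theorem hasDerivAt_energy (h : IsAdmissible C₁ C₂) {u : ℝ → E × E} {x t : ℝ}
    (hu : HasDerivAt u (x • geodesicField C₁ C₂ (u t)) t) (h0 : (u t).1 ≠ 0) :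
    HasDerivAt (fun t => innerMetric C₁ C₂ (u t).1 (u t).2 (u t).2) 0 t := by
  have hf : HasDerivAt (fun t => (u t).1) (x • (u t).2) t := hu.fst
  have hv : HasDerivAt (fun t => (u t).2) (x • geodesicAcc C₁ C₂ (u t).1 (u t).2) t := hu.snd
  have hq := hf.inner ℝ hf
  have hp := hf.inner ℝ hv
  have he := hv.inner ℝ hv
  have hpos : 0 < inner ℝ (u t).1 (u t).1 := real_inner_self_pos.2 h0
  have h1 := (h.hasDerivAt₁ hpos).comp t hq
  have h2 := (h.hasDerivAt₂ hpos).comp t hq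
  have := ((h1.const_mul 4).fun_mul he).fun_add ((h2.const_mul 4).fun_mul (hp.fun_mul hp))
  refine this.congr_deriv ?_
  have n1 := (h.pos _ hpos).ne'
  have n2 := (h.add_mul_pos hpos).ne'
  have hA := h.accPos_mul_add hpos (inner ℝ (u t).1 (u t).2) (inner ℝ (u t).2 (u t).2)
  have hB : C₁ (inner ℝ (u t).1 (u t).1) * accPos C₁ C₂ (inner ℝ (u t).1 (u t).1)
      (inner ℝ (u t).1 (u t).2) (inner ℝ (u t).2 (u t).2) = _ := mul_div_cancel₀ _ n1
  have hD : C₁ (inner ℝ (u t).1 (u t).1) * accVel C₁ (inner ℝ (u t).1 (u t).1)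
      (inner ℝ (u t).1 (u t).2) = _ := mul_div_cancel₀ _ n1
  rw [← hA] at hB
  simp only [geodesicAcc, inner_add_left, inner_add_right, real_inner_smul_left,
    real_inner_smul_right, real_inner_comm (u t).1 (u t).2, Function.comp_apply]
  linear_combination (8 * x * inner ℝ (u t).1 (u t).2) * hB + (8 * x * inner ℝ (u t).2 (u t).2) * hD

end IsAdmissible

/-- In finite dimension the geodesic spray has an integral curve on `ℝ` through each point: the
energy `𝓔` is conserved and `|∂ₜ W(‖f‖)| ≤ √𝓔`, hence `W(‖f‖)` stays bounded in finite time. As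
the range of `W` is `ℝ`, this keeps the curve in a compact annulus, where the energy controls the
velocity. -/
theorem IsCompleteAdmissible.exists_hasDerivAt_geodesicField [FiniteDimensional ℝ E]
    (h : IsCompleteAdmissible C₁ C₂) {u₀ : E × E} (hu₀ : u₀.1 ≠ 0) :
    ∃ u : ℝ → E × E, u 0 = u₀ ∧
      ∀ t, (u t).1 ≠ 0 ∧ HasDerivAt u (geodesicField C₁ C₂ (u t)) t := by
  have : ProperSpace E := FiniteDimensional.proper ℝ E
  refine exists_hasDerivAt_of_forall_mem_compact isOpen_fst_ne_zero
    (h.contDiffOn_geodesicField.of_le (by exact_mod_cast le_top)) hu₀ fun T hT => ?_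
  set e₀ := innerMetric C₁ C₂ u₀.1 u₀.2 u₀.2
  set a := radius C₁ C₂ (W C₁ C₂ ‖u₀.1‖ - √e₀ * T)
  set b := radius C₁ C₂ (W C₁ C₂ ‖u₀.1‖ + √e₀ * T)
  obtain ⟨m, hm, hmle⟩ := h.exists_mul_norm_le (E := E) (a := a) b (h.radius_pos _)
  refine ⟨(Metric.closedBall 0 b ∩ {f | a ≤ ‖f‖}) ×ˢ Metric.closedBall 0 (√e₀ / m), ?_, ?_, ?_⟩
  · rintro ⟨f, v⟩ ⟨⟨-, hf⟩, -⟩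
    exact norm_pos_iff.1 ((h.radius_pos _).trans_le hf)
  · exact ((isCompact_closedBall _ _).inter_right
      (isClosed_le continuous_const continuous_norm)).prod (isCompact_closedBall _ _)
  intro χ hχ u hu0 hu
  have h0 : (0 : ℝ) ∈ Ioo (-T) T := ⟨by linarith, hT⟩
  have henergy : ∀ t ∈ Ioo (-T) T, innerMetric C₁ C₂ (u t).1 (u t).2 (u t).2 = e₀ := by
    intro t ht
    have := (convex_Ioo (-T) T).is_const_of_fderivWithin_eq_zero (𝕜 := ℝ)
      (f := fun t => innerMetric C₁ C₂ (u t).1 (u t).2 (u t).2)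
      (fun r hr => (h.hasDerivAt_energy (hu r hr).2
        (hu r hr).1).differentiableAt.differentiableWithinAt)
      (fun r hr => by
        rw [fderivWithin_of_isOpen isOpen_Ioo hr]
        simpa using (h.hasDerivAt_energy (hu r hr).2 (hu r hr).1).hasFDerivAt.fderiv) ht h0
    rw [this, hu0]
  have hW : ∀ t ∈ Ioo (-T) T, |W C₁ C₂ ‖(u t).1‖ - W C₁ C₂ ‖u₀.1‖| ≤ √e₀ * T := by
    intro t ht
    have hd : ∀ r ∈ Ioo (-T) T, HasDerivWithinAt (fun t => W C₁ C₂ ‖(u t).1‖)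
        (√(g₂ C₁ C₂ ‖(u r).1‖) * (‖(u r).1‖⁻¹ * inner ℝ (u r).1 (χ (u r) • (u r).2)))
        (Ioo (-T) T) r := fun r hr => by
      have hr1 : HasDerivAt (fun t => (u t).1) (χ (u r) • (u r).2) r := (hu r hr).2.fst
      exact h.hasDerivWithinAt_W_norm hr1.hasDerivWithinAt (hu r hr).1
    have hbound : ∀ r ∈ Ioo (-T) T, ‖√(g₂ C₁ C₂ ‖(u r).1‖) *
        (‖(u r).1‖⁻¹ * inner ℝ (u r).1 (χ (u r) • (u r).2))‖ ≤ √e₀ := by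
      intro r hr
      have h1 : |√(g₂ C₁ C₂ ‖(u r).1‖) * (‖(u r).1‖⁻¹ * inner ℝ (u r).1 (u r).2)| ≤ √e₀ := by
        rw [← henergy r hr]
        exact Real.abs_le_sqrt (h.sq_radial_le (hu r hr).1 _)
      have h2 : √(g₂ C₁ C₂ ‖(u r).1‖) *
          (‖(u r).1‖⁻¹ * inner ℝ (u r).1 (χ (u r) • (u r).2)) = χ (u r) *
          (√(g₂ C₁ C₂ ‖(u r).1‖) * (‖(u r).1‖⁻¹ * inner ℝ (u r).1 (u r).2)) := by
        rw [real_inner_smul_right]; ring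
      rw [h2, Real.norm_eq_abs, abs_mul, abs_of_nonneg (hχ (u r)).1]
      exact (mul_le_of_le_one_left (abs_nonneg _) (hχ (u r)).2).trans h1
    have := (convex_Ioo (-T) T).norm_image_sub_le_of_norm_hasDerivWithin_le hd hbound h0 ht
    rw [hu0, sub_zero] at this
    refine this.trans (mul_le_mul_of_nonneg_left ?_ (Real.sqrt_nonneg _))
    exact (abs_lt.2 ht).le
  intro t ht
  have hWt := abs_le.1 (hW t ht)
  have hann : ‖(u t).1‖ ∈ Icc a b := h.mem_Icc_radius (norm_pos_iff.2 (hu t ht).1)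
    (by linarith [hWt.1]) (by linarith [hWt.2])
  refine ⟨⟨by simpa using hann.2, hann.1⟩, ?_⟩
  rw [mem_closedBall_zero_iff, le_div_iff₀ hm, mul_comm]
  refine Real.le_sqrt_of_sq_le ?_
  rw [← henergy t ht]
  exact hmle _ hann _

/-- The geodesic with given initial position and velocity stays in the (finite-dimensional) span
of these two vectors and exists for all time. -/
theorem IsCompleteAdmissible.exists_geodesic (h : IsCompleteAdmissible C₁ C₂) {f : E}
    (hf : f ≠ 0) (k : E) (t₀ : ℝ) :
    ∃ V : Submodule ℝ E, FiniteDimensional ℝ V ∧ ∃ c v b : ℝ → V,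
      (ContDiff ℝ ∞ c ∧ (c t₀ : E) = f ∧ (v t₀ : E) = k) ∧
      ∀ t, (c t : E) ≠ 0 ∧ HasDerivAt c (v t) t ∧ HasDerivAt v (b t) t ∧
        (b t : E) = geodesicAcc C₁ C₂ (c t : E) (v t : E) := by
  set V : Submodule ℝ E := Submodule.span ℝ {f, k}
  have hfV : f ∈ V := Submodule.subset_span (by simp)
  have hkV : k ∈ V := Submodule.subset_span (by simp)
  have hfin : FiniteDimensional ℝ V := FiniteDimensional.span_of_finite ℝ (by simp)
  obtain ⟨u, hu0, hu⟩ := h.exists_hasDerivAt_geodesicField (u₀ := ((⟨f, hfV⟩, ⟨k, hkV⟩) : V × V))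
    (by simpa [Subtype.ext_iff] using hf)
  have hsmooth : ContDiff ℝ ∞ u := contDiffOn_univ.1
    (contDiffOn_of_hasDerivAt h.contDiffOn_geodesicField isOpen_univ fun t _ => hu t)
  have hshift : ContDiff ℝ ∞ fun t => u (t - t₀) := hsmooth.comp (contDiff_id.sub contDiff_const)
  have hd : ∀ t, HasDerivAt (fun t => u (t - t₀)) (geodesicField C₁ C₂ (u (t - t₀))) t :=
    fun t => (hu (t - t₀)).2.comp_sub_const t t₀
  refine ⟨V, hfin, fun t => (u (t - t₀)).1, fun t => (u (t - t₀)).2,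
    fun t => (geodesicField C₁ C₂ (u (t - t₀))).2,
    ⟨contDiff_fst.comp hshift, by simp [hu0], by simp [hu0]⟩,
    fun t => ⟨fun h0 => (hu (t - t₀)).1 (by simpa using h0), (hd t).fst, (hd t).snd, ?_⟩⟩
  simp [geodesicField, geodesicAcc]

/-- Geodesics are determined by their position and velocity at one time. -/
theorem IsAdmissible.geodesic_unique (h : IsAdmissible C₁ C₂) {J : Set ℝ} (hJ : IsOpen J)
    (hJc : J.OrdConnected) {c v c' v' : ℝ → E}
    (hc : ∀ t ∈ J, c t ≠ 0 ∧ HasDerivAt c (v t) t ∧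
      HasDerivAt v (geodesicAcc C₁ C₂ (c t) (v t)) t)
    (hc' : ∀ t ∈ J, c' t ≠ 0 ∧ HasDerivAt c' (v' t) t ∧
      HasDerivAt v' (geodesicAcc C₁ C₂ (c' t) (v' t)) t)
    {t₀ : ℝ} (ht₀ : t₀ ∈ J) (h0 : c t₀ = c' t₀) (h1 : v t₀ = v' t₀) : EqOn c c' J := by
  have := eqOn_of_hasDerivAt (isOpen_fst_ne_zero (E := E))
    (h.contDiffOn_geodesicField.of_le (by exact_mod_cast le_top)) hJ hJc.isPreconnected
    (u := fun t => (c t, v t)) (w := fun t => (c' t, v' t))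
    (fun t ht => ⟨(hc t ht).1, (hc t ht).2.1.prodMk (hc t ht).2.2⟩)
    (fun t ht => ⟨(hc' t ht).1, (hc' t ht).2.1.prodMk (hc' t ht).2.2⟩) ht₀ (by simp [h0, h1])
  exact fun t ht => congrArg Prod.fst (this ht)

theorem IsCompleteAdmissible.exists_isGeodesicOn (h : IsCompleteAdmissible C₁ C₂) {f : E}
    (hf : f ≠ 0) (k : E) (t₀ : ℝ) :
    ∃ c : ℝ → E, IsGeodesicOn (innerMetric C₁ C₂) univ c ∧ c t₀ = f ∧ deriv c t₀ = k ∧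
      ∀ t, HasDerivAt (deriv c) (geodesicAcc C₁ C₂ (c t) (deriv c t)) t := by
  obtain ⟨V, _, c, v, b, ⟨hcs, hc0, hv0⟩, hc⟩ := h.exists_geodesic hf k t₀
  have hd : ∀ t, HasDerivAt (fun t => (c t : E)) (v t) t := fun t =>
    V.subtypeL.hasFDerivAt.comp_hasDerivAt t (hc t).2.1
  have hd2 : ∀ t, HasDerivAt (fun t => (v t : E)) (b t) t := fun t =>
    V.subtypeL.hasFDerivAt.comp_hasDerivAt t (hc t).2.2.1
  have hderiv : deriv (fun t => (c t : E)) = fun t => (v t : E) := funext fun t => (hd t).deriv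
  refine ⟨fun t => c t, ⟨?_, fun t _ => (hc t).1, fun t _ => ?_⟩, hc0, ?_, fun t => ?_⟩
  · exact (V.subtypeL.contDiff.comp hcs).contDiffOn
  · rw [hderiv, (hd2 t).deriv, h.geodesicEquation_iff (hc t).1]
    exact (hc t).2.2.2
  · rw [hderiv]
    exact hv0
  · rw [hderiv, ← (hc t).2.2.2]
    exact hd2 t

theorem IsCompleteAdmissible.geodesicallyComplete (h : IsCompleteAdmissible C₁ C₂) :
    GeodesicallyComplete (innerMetric C₁ C₂ (E := E)) where
  exists_geodesic f k hf := by
    obtain ⟨c, hc, hc0, hc1, -⟩ := h.exists_isGeodesicOn hf k 0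
    exact ⟨c, hc, hc0, hc1⟩
  extend J c hJ hJc hJn hc := by
    obtain ⟨t₀, ht₀⟩ := hJn
    obtain ⟨c', hc', h0, h1, h2⟩ := h.exists_isGeodesicOn (hc.ne_zero t₀ ht₀) (deriv c t₀) t₀
    refine ⟨c', hc', h.geodesic_unique hJ hJc (v := deriv c') (v' := deriv c) (fun t _ =>
      ⟨hc'.ne_zero t trivial, ?_, h2 t⟩) (fun t ht => ⟨hc.ne_zero t ht, ?_, ?_⟩) ht₀ h0 h1⟩
    · exact ((hc'.smooth.contDiffAt univ_mem).differentiableAt (by simp)).hasDerivAt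
    · exact ((hc.smooth.contDiffAt (hJ.mem_nhds ht)).differentiableAt (by simp)).hasDerivAt
    · have hd := ((contDiffOn_infty_iff_deriv_of_isOpen hJ).1 hc.smooth).2
      rw [← (h.geodesicEquation_iff (hc.ne_zero t ht) _ _).1 (hc.equation t ht)]
      exact ((hd.contDiffAt (hJ.mem_nhds ht)).differentiableAt (by simp)).hasDerivAt

end Geodesics

/-! ### Metric completeness -/

section MetricCompleteness

variable {C₁ C₂ : ℝ → ℝ} {E : Type*} [NormedAddCommGroup E] [InnerProductSpace ℝ E]

/-- A function along a curve whose speed is at most the speed of the curve changes by at most the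
length of the curve. -/
theorem enorm_sub_le_curveLength {F : Type*} [NormedAddCommGroup F] [NormedSpace ℝ F]
    {G : E → E → E → ℝ} {c : ℝ → E} {φ φ' : ℝ → F} (hφ : ContDiffOn ℝ 1 φ (Icc 0 1))
    (hd : ∀ r ∈ Icc (0 : ℝ) 1, HasDerivWithinAt φ (φ' r) (Icc 0 1) r) {t : ℝ}
    (ht : t ∈ Icc (0 : ℝ) 1)
    (hle : ∀ r ∈ Icc (0 : ℝ) 1, r ≤ t → ‖φ' r‖ ≤
      √(G (c r) (derivWithin c (Icc 0 1) r) (derivWithin c (Icc 0 1) r))) :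
    ‖φ t - φ 0‖ₑ ≤ curveLength G c := by
  have hsub : Icc 0 t ⊆ Icc (0 : ℝ) 1 := Icc_subset_Icc_right ht.2
  refine (enorm_sub_le_lintegral_deriv_of_contDiffOn_Icc (hφ.mono hsub) ht.1).trans ?_
  refine le_trans ?_ (lintegral_mono_set hsub)
  refine lintegral_mono_ae ?_
  rw [← restrict_Ioo_eq_restrict_Icc]
  filter_upwards [self_mem_ae_restrict measurableSet_Ioo] with r hr
  have hr1 : r ∈ Icc (0 : ℝ) 1 := hsub (Ioo_subset_Icc_self hr)
  rw [((hd r hr1).hasDerivAt (Icc_mem_nhds hr.1 (hr.2.trans_le ht.2))).deriv,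
    ← ofReal_norm]
  exact ENNReal.ofReal_le_ofReal (hle r hr1 hr.2.le)

theorem geodDist_le_curveLength {G : E → E → E → ℝ} {c : ℝ → E}
    (hc : ContDiffOn ℝ 1 c (Icc 0 1)) (h0 : ∀ t ∈ Icc (0 : ℝ) 1, c t ≠ 0) :
    geodDist G (c 0) (c 1) ≤ curveLength G c :=
  iInf_le_of_le c <| iInf_le_of_le hc <| iInf_le_of_le h0 <| iInf_le_of_le rfl <|
    iInf_le_of_le rfl le_rfl

namespace IsAdmissible

theorem enorm_W_sub_le_curveLength (h : IsAdmissible C₁ C₂) {c : ℝ → E}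
    (hc : ContDiffOn ℝ 1 c (Icc 0 1)) (h0 : ∀ t ∈ Icc (0 : ℝ) 1, c t ≠ 0) {t : ℝ}
    (ht : t ∈ Icc (0 : ℝ) 1) :
    ‖W C₁ C₂ ‖c t‖ - W C₁ C₂ ‖c 0‖‖ₑ ≤ curveLength (innerMetric C₁ C₂) c := by
  have hn : ContDiffOn ℝ 1 (fun t => ‖c t‖) (Icc 0 1) := hc.norm ℝ h0
  refine enorm_sub_le_curveLength (φ := fun t => W C₁ C₂ ‖c t‖)
    ((h.contDiffOn_W.of_le (by exact_mod_cast le_top)).comp hn fun r hr => norm_pos_iff.2 (h0 r hr))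
    (fun r hr => h.hasDerivWithinAt_W_norm
      (hc.differentiableOn one_ne_zero r hr).hasDerivWithinAt (h0 r hr)) ht fun r hr _ => ?_
  exact Real.abs_le_sqrt (h.sq_radial_le (h0 r hr) _)

theorem enorm_W_sub_le_geodDist (h : IsAdmissible C₁ C₂) (f g : E) :
    ‖W C₁ C₂ ‖g‖ - W C₁ C₂ ‖f‖‖ₑ ≤ geodDist (innerMetric C₁ C₂) f g := by
  refine le_iInf fun c => le_iInf fun hc => le_iInf fun h0 => le_iInf fun hf => le_iInf fun hg => ?_
  subst hf hg
  exact h.enorm_W_sub_le_curveLength hc h0 ⟨zero_le_one, le_rfl⟩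

/-- Near `f`, the geodesic distance is at most a multiple of the distance of the norm: compare
with the length of the segment. -/
theorem exists_geodDist_le (h : IsAdmissible C₁ C₂) {f : E} (hf : f ≠ 0) :
    ∃ L : ℝ, ∀ g : E, ‖g - f‖ < ‖f‖ / 2 →
      geodDist (innerMetric C₁ C₂) g f ≤ ENNReal.ofReal (L * ‖g - f‖) := by
  have hf0 : 0 < ‖f‖ := norm_pos_iff.2 hf
  obtain ⟨L, hL0, hL⟩ := h.exists_le_mul_norm (E := E) (a := ‖f‖ / 2) (‖f‖ / 2 + ‖f‖)
    (by positivity)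
  refine ⟨L, fun g hg => ?_⟩
  set c : ℝ → E := fun t => g + t • (f - g) with hc
  have hann : ∀ t ∈ Icc (0 : ℝ) 1, ‖c t‖ ∈ Icc (‖f‖ / 2) (‖f‖ / 2 + ‖f‖) := by
    intro t ht
    have h1 : c t = (1 - t) • (g - f) + f := by simp only [hc]; module
    have h2 : ‖(1 - t) • (g - f)‖ ≤ ‖f‖ / 2 := by
      rw [norm_smul, Real.norm_of_nonneg (sub_nonneg.2 ht.2)]
      exact (mul_le_of_le_one_left (norm_nonneg _) (by linarith [ht.1])).trans hg.le
    rw [h1]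
    refine ⟨?_, (norm_add_le _ _).trans (by linarith)⟩
    have := norm_sub_le_norm_add f ((1 - t) • (g - f))
    rw [add_comm] at this
    linarith
  have hd : ∀ t, HasDerivAt c (f - g) t := fun t => by
    have := ((hasDerivAt_id t).smul_const (f - g)).const_add g
    rwa [one_smul] at this
  have hcs : ContDiff ℝ 1 c := contDiff_const.add (contDiff_id.smul contDiff_const)
  have hlen := geodDist_le_curveLength (G := innerMetric C₁ C₂) hcs.contDiffOn
    fun t ht => norm_pos_iff.1 (lt_of_lt_of_le (by positivity) (hann t ht).1)
  rw [show c 0 = g by simp [hc], show c 1 = f by simp [hc]] at hlen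
  refine hlen.trans ?_
  have hconst : ∀ t ∈ Icc (0 : ℝ) 1, ENNReal.ofReal
      √(innerMetric C₁ C₂ (c t) (derivWithin c (Icc 0 1) t) (derivWithin c (Icc 0 1) t)) ≤
      ENNReal.ofReal (L * ‖g - f‖) := by
    intro t ht
    rw [(hd t).hasDerivWithinAt.derivWithin (uniqueDiffOn_Icc_zero_one t ht), norm_sub_rev]
    exact ENNReal.ofReal_le_ofReal (Real.sqrt_le_iff.2
      ⟨mul_nonneg hL0 (norm_nonneg _), hL _ (hann t ht) _⟩)
  refine (setLIntegral_mono' measurableSet_Icc hconst).trans ?_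
  simp

end IsAdmissible

namespace IsCompleteAdmissible

/-- On bounded sets, a multiple of the distance of the norm is at most the geodesic distance:
short curves stay in an annulus. -/
theorem exists_mul_norm_sub_le_geodDist (h : IsCompleteAdmissible C₁ C₂) (s : ℝ) :
    ∃ m : ℝ, 0 < m ∧ ∀ f g : E, |W C₁ C₂ ‖f‖ - s| ≤ 1 →
      geodDist (innerMetric C₁ C₂) f g < 1 →
      ENNReal.ofReal (m * ‖g - f‖) ≤ geodDist (innerMetric C₁ C₂) f g := by
  obtain ⟨m, hm, hmle⟩ := h.exists_mul_norm_le (E := E) (a := radius C₁ C₂ (s - 2))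
    (radius C₁ C₂ (s + 2)) (h.radius_pos _)
  refine ⟨m, hm, fun f g hf hdist => ?_⟩
  -- the infimum only involves curves of length less than `1`, which stay in the annulus
  have key : ∀ c : ℝ → E, ContDiffOn ℝ 1 c (Icc 0 1) → (∀ t ∈ Icc (0 : ℝ) 1, c t ≠ 0) → c 0 = f →
      c 1 = g → curveLength (innerMetric C₁ C₂) c < 1 →
      ENNReal.ofReal (m * ‖g - f‖) ≤ curveLength (innerMetric C₁ C₂) c := by
    rintro c hc h0 rfl rfl hlen
    have hann : ∀ t ∈ Icc (0 : ℝ) 1,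
        ‖c t‖ ∈ Icc (radius C₁ C₂ (s - 2)) (radius C₁ C₂ (s + 2)) := by
      intro t ht
      have h1 := (h.enorm_W_sub_le_curveLength hc h0 ht).trans_lt hlen
      rw [← ofReal_norm, ENNReal.ofReal_lt_one, Real.norm_eq_abs] at h1
      have h2 := abs_lt.1 h1
      have h3 := abs_le.1 hf
      exact h.mem_Icc_radius (norm_pos_iff.2 (h0 t ht)) (by linarith [h2.1, h3.1])
        (by linarith [h2.2, h3.2])
    have := enorm_sub_le_curveLength (G := innerMetric C₁ C₂) (c := c) (φ := fun t => m • c t)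
      (contDiffOn_const.smul hc)
      (fun r hr => ((hc.differentiableOn one_ne_zero r hr).hasDerivWithinAt).const_smul m)
      (t := 1) ⟨zero_le_one, le_rfl⟩ fun r hr _ => by
        rw [norm_smul, Real.norm_of_nonneg hm.le]
        exact Real.le_sqrt_of_sq_le (hmle _ (hann r hr) _)
    rwa [← smul_sub, ← ofReal_norm, norm_smul, Real.norm_of_nonneg hm.le] at this
  obtain ⟨c₁, hc₁⟩ := iInf_lt_iff.1 hdist
  simp only [iInf_lt_iff] at hc₁
  obtain ⟨hc, h0, hf0, hg0, hlen⟩ := hc₁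
  refine le_iInf fun c => le_iInf fun hc' => le_iInf fun h0' => le_iInf fun hf' =>
    le_iInf fun hg' => ?_
  rcases lt_or_ge (curveLength (innerMetric C₁ C₂) c) 1 with hlt | hge
  · exact key c hc' h0' hf' hg' hlt
  · exact (key c₁ hc h0 hf0 hg0 hlen).trans (hlen.le.trans hge)

theorem metricallyComplete [CompleteSpace E] (h : IsCompleteAdmissible C₁ C₂) :
    MetricallyComplete (innerMetric C₁ C₂ (E := E)) where
  eq_of_dist_eq_zero f g _ _ hfg := by
    obtain ⟨m, hm, hmle⟩ := h.exists_mul_norm_sub_le_geodDist (E := E) (W C₁ C₂ ‖f‖)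
    have := hmle f g (by simp) (by rw [hfg]; exact one_pos)
    rw [hfg, nonpos_iff_eq_zero, ENNReal.ofReal_eq_zero] at this
    have h1 : ‖g - f‖ ≤ 0 := by
      by_contra! hpos
      exact absurd (mul_pos hm hpos) this.not_gt
    exact (sub_eq_zero.1 (norm_le_zero_iff.1 h1)).symm
  complete u hu hcau := by
    obtain ⟨N, hN⟩ := hcau 1 one_pos
    set s := W C₁ C₂ ‖u N‖
    obtain ⟨m, hm, hmle⟩ := h.exists_mul_norm_sub_le_geodDist (E := E) s
    -- beyond `N` the sequence stays in an annulus
    have hW : ∀ i ≥ N, |W C₁ C₂ ‖u i‖ - s| ≤ 1 := by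
      intro i hi
      have h1 := (h.enorm_W_sub_le_geodDist (u N) (u i)).trans_lt (hN N le_rfl i hi)
      rw [← ofReal_norm, ENNReal.ofReal_lt_one, Real.norm_eq_abs] at h1
      exact h1.le
    have hC : CauchySeq u := by
      refine Metric.cauchySeq_iff.2 fun ε hε => ?_
      obtain ⟨N', hN'⟩ := hcau (ENNReal.ofReal (m * ε)) (ENNReal.ofReal_pos.2 (mul_pos hm hε))
      refine ⟨max N N', fun i hi j hj => ?_⟩
      have hiN := (le_max_left _ _).trans hi
      have hjN := (le_max_left _ _).trans hj
      have h1 := (hmle (u j) (u i) (hW j hjN) (hN j hjN i hiN)).trans_lt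
        (hN' j ((le_max_right _ _).trans hj) i ((le_max_right _ _).trans hi))
      rw [ENNReal.ofReal_lt_ofReal_iff (mul_pos hm hε)] at h1
      rw [dist_eq_norm]
      exact lt_of_mul_lt_mul_left h1 hm.le
    obtain ⟨f, hf⟩ := cauchySeq_tendsto_of_complete hC
    have hf0 : f ≠ 0 := by
      have hge : radius C₁ C₂ (s - 1) ≤ ‖f‖ := by
        refine ge_of_tendsto hf.norm ?_
        filter_upwards [eventually_ge_atTop N] with i hi
        have := abs_le.1 (hW i hi)
        exact (h.mem_Icc_radius (norm_pos_iff.2 (hu i)) (by linarith [this.1]) le_rfl).1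
      exact norm_pos_iff.1 ((h.radius_pos _).trans_le hge)
    refine ⟨f, hf0, ?_⟩
    obtain ⟨L, hL⟩ := h.exists_geodDist_le hf0
    have hsub : Tendsto (fun n => ‖u n - f‖) atTop (𝓝 0) := tendsto_iff_norm_sub_tendsto_zero.1 hf
    have hlim : Tendsto (fun n => ENNReal.ofReal (L * ‖u n - f‖)) atTop (𝓝 0) := by
      simpa using ENNReal.tendsto_ofReal (hsub.const_mul L)
    refine tendsto_of_tendsto_of_tendsto_of_le_of_le' tendsto_const_nhds hlim
      (.of_forall fun _ => zero_le) ?_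
    filter_upwards [hsub.eventually (gt_mem_nhds (half_pos (norm_pos_iff.2 hf0)))] with n hn
    exact hL _ hn

end IsCompleteAdmissible

end MetricCompleteness

/-! ### Smooth densities in charts -/

section Densities

/-- A density that factors through a map can be pushed forward separately. -/
theorem map_withDensity_comp {X Y : Type*} [MeasurableSpace X] [MeasurableSpace Y] {μ : Measure X}
    {φ : X → Y} (hφ : AEMeasurable φ μ) {g : Y → ENNReal} (hg : AEMeasurable g (μ.map φ)) :
    (μ.withDensity (g ∘ φ)).map φ = (μ.map φ).withDensity g := by
  have hgφ : AEMeasurable (g ∘ φ) μ := hg.comp_aemeasurable hφ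
  refine Measure.ext_of_lintegral _ fun k hk => ?_
  rw [lintegral_map' hk.aemeasurable (hφ.mono_ac (withDensity_absolutelyContinuous _ _))]
  refine (lintegral_withDensity_eq_lintegral_mul₀ hgφ (hk.comp_aemeasurable hφ)).trans ?_
  rw [lintegral_withDensity_eq_lintegral_mul₀ hg hk.aemeasurable,
    lintegral_map' (hg.mul hk.aemeasurable) hφ]
  rfl

variable {m : ℕ} {H : Type*} [TopologicalSpace H]
  {I : ModelWithCorners ℝ (EuclideanSpace ℝ (Fin m)) H}
  {M : Type*} [TopologicalSpace M] [ChartedSpace H M]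

theorem measurableSet_extChartAt_target (x : M) : MeasurableSet (extChartAt I x).target := by
  rw [extChartAt_target]
  exact ((chartAt H x).open_target.preimage I.continuous_symm).measurableSet.inter
    I.isClosed_range.measurableSet

theorem aemeasurable_ofReal_of_continuousOn {ρ : EuclideanSpace ℝ (Fin m) → ℝ} {x : M}
    (hρ : ContinuousOn ρ (extChartAt I x).target) :
    AEMeasurable (fun y => ENNReal.ofReal (ρ y)) (volume.restrict (extChartAt I x).target) :=
  (hρ.aemeasurable (measurableSet_extChartAt_target x)).ennreal_ofReal

variable [MeasurableSpace M] [BorelSpace M]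

theorem measurableSet_extChartAt_source (x : M) : MeasurableSet (extChartAt I x).source :=
  (isOpen_extChartAt_source x).measurableSet

theorem aemeasurable_extChartAt (μ : Measure M) (x : M) :
    AEMeasurable (extChartAt I x) (μ.restrict (extChartAt I x).source) :=
  (continuousOn_extChartAt x).aemeasurable (measurableSet_extChartAt_source x)

/-- A measure carried by a chart domain is determined by its image under the chart. -/
theorem map_symm_map_extChartAt (μ : Measure M) (x : M) :
    ((μ.restrict (extChartAt I x).source).map (extChartAt I x)).map (extChartAt I x).symm =
      μ.restrict (extChartAt I x).source := by
  have hφ := aemeasurable_extChartAt (I := I) μ x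
  have hS := measurableSet_extChartAt_source (I := I) x
  have hT := measurableSet_extChartAt_target (I := I) x
  have hres : ((μ.restrict (extChartAt I x).source).map (extChartAt I x)).restrict
      (extChartAt I x).target = (μ.restrict (extChartAt I x).source).map (extChartAt I x) := by
    refine Measure.restrict_eq_self_of_ae_mem ((ae_map_iff hφ hT).2 ?_)
    filter_upwards [ae_restrict_mem hS] with y hy using (extChartAt I x).map_source hy
  have hsymm : AEMeasurable (extChartAt I x).symm
      ((μ.restrict (extChartAt I x).source).map (extChartAt I x)) := by
    rw [← hres]
    exact (continuousOn_extChartAt_symm x).aemeasurable hT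
  rw [AEMeasurable.map_map_of_aemeasurable hsymm hφ]
  refine (Measure.map_congr ?_).trans Measure.map_id
  filter_upwards [ae_restrict_mem hS] with y hy using (extChartAt I x).left_inv hy

/-- Multiplication of a measure by a function `F` acts on its image in a chart as multiplication
by `F` read in the chart. -/
theorem map_restrict_withDensity (μ : Measure M) (x : M) {F : M → ENNReal}
    {g ρ : EuclideanSpace ℝ (Fin m) → ENNReal}
    (hμ : (μ.restrict (extChartAt I x).source).map (extChartAt I x) =
      (volume.restrict (extChartAt I x).target).withDensity ρ)
    (hρ : AEMeasurable ρ (volume.restrict (extChartAt I x).target))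
    (hg : AEMeasurable g (volume.restrict (extChartAt I x).target))
    (hF : ∀ y ∈ (extChartAt I x).source, F y = g (extChartAt I x y)) :
    ((μ.withDensity F).restrict (extChartAt I x).source).map (extChartAt I x) =
      (volume.restrict (extChartAt I x).target).withDensity (ρ * g) := by
  have hS := measurableSet_extChartAt_source (I := I) x
  have hFae : F =ᵐ[μ.restrict (extChartAt I x).source] g ∘ extChartAt I x := by
    filter_upwards [ae_restrict_mem hS] with y hy using hF y hy
  rw [restrict_withDensity hS, withDensity_congr_ae hFae,
    map_withDensity_comp (aemeasurable_extChartAt μ x), hμ, withDensity_mul₀ hρ hg]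
  rw [hμ]
  exact hg.mono_ac (withDensity_absolutelyContinuous _ _)

/-- A smooth positive density charges every nonempty open set. At a boundary point this holds
because the range of a model with corners is contained in the closure of its interior. -/
theorem IsSmoothPosDensity.isOpenPosMeasure {μ : Measure M} (hμ : IsSmoothPosDensity I μ) :
    μ.IsOpenPosMeasure where
  open_pos U hU := by
    rintro ⟨x, hx⟩ h0
    obtain ⟨ρ, hρ, hρpos, hmap⟩ := hμ x
    have hA : (extChartAt I x).target ∩ (extChartAt I x).symm ⁻¹' U ∈
        𝓝[range I] (extChartAt I x x) := by
      refine inter_mem (extChartAt_target_mem_nhdsWithin x) (mem_nhdsWithin_of_mem_nhds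
        ((continuousAt_extChartAt_symm (I := I) x).preimage_mem_nhds ?_))
      rw [extChartAt_to_inv]
      exact hU.mem_nhds hx
    obtain ⟨O, hO, hxO, hOA⟩ := mem_nhdsWithin.1 hA
    have hne : (O ∩ interior (range I)).Nonempty :=
      mem_closure_iff.1 (I.range_subset_closure_interior (by simp)) O hO hxO
    refine ((hO.inter isOpen_interior).measure_pos volume hne).ne' (measure_mono_null
      ((inter_subset_inter_right _ interior_subset).trans hOA) ?_)
    -- `U` is a null set, hence so is its image in the chart
    have hnull : (volume.restrict (extChartAt I x).target).withDensity
        (fun y => ENNReal.ofReal (ρ y)) ((extChartAt I x).symm ⁻¹' U) = 0 := by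
      rw [measure_eq_zero_iff_ae_notMem]
      refine ae_of_ae_map (p := fun z => z ∉ U) (((continuousOn_extChartAt_symm x).aemeasurable
        (measurableSet_extChartAt_target x)).mono_ac (withDensity_absolutelyContinuous _ _)) ?_
      rw [← hmap, map_symm_map_extChartAt]
      exact ae_restrict_of_ae (measure_eq_zero_iff_ae_notMem.1 h0)
    rw [withDensity_apply_eq_zero' (aemeasurable_ofReal_of_continuousOn hρ.continuousOn),
      Measure.restrict_apply_eq_zero' (measurableSet_extChartAt_target x)] at hnull
    refine measure_mono_null (fun y hy => ?_) hnull
    exact ⟨⟨by simpa using hρpos y hy.1, hy.2⟩, hy.1⟩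

/-- The ratio of two smooth positive densities in a chart is the square of a smooth positive
function. -/
theorem IsSmoothPosDensity.exists_local_sqrt [IsManifold I ∞ M] {μ μ₀ : Measure M}
    (hμ : IsSmoothPosDensity I μ) (hμ₀ : IsSmoothPosDensity I μ₀) (x : M) :
    ∃ r : M → ℝ, ContMDiffOn I 𝓘(ℝ, ℝ) ∞ r (extChartAt I x).source ∧
      (∀ y ∈ (extChartAt I x).source, 0 < r y) ∧
      μ.restrict (extChartAt I x).source = (sqDens μ₀ r).restrict (extChartAt I x).source := by
  obtain ⟨ρ, hρ, hρpos, hmap⟩ := hμ x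
  obtain ⟨ρ₀, hρ₀, hρ₀pos, hmap₀⟩ := hμ₀ x
  set w : EuclideanSpace ℝ (Fin m) → ℝ := fun y => √(ρ y / ρ₀ y) with hw
  have hwc : ContDiffOn ℝ ∞ w (extChartAt I x).target :=
    (hρ.div hρ₀ fun y hy => (hρ₀pos y hy).ne').sqrt fun y hy =>
      (div_pos (hρpos y hy) (hρ₀pos y hy)).ne'
  refine ⟨fun y => w (extChartAt I x y), ?_, fun y hy => ?_, ?_⟩
  · refine hwc.contMDiffOn.comp (t := (extChartAt I x).target) ?_ fun y hy =>
      (extChartAt I x).map_source hy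
    rw [extChartAt_source]
    exact contMDiffOn_extChartAt
  · have := (extChartAt I x).map_source hy
    exact Real.sqrt_pos.2 (div_pos (hρpos _ this) (hρ₀pos _ this))
  · rw [← map_symm_map_extChartAt (I := I) μ, ← map_symm_map_extChartAt (I := I) (sqDens _ _), hmap,
      sqDens, map_restrict_withDensity μ₀ x hmap₀
        (aemeasurable_ofReal_of_continuousOn hρ₀.continuousOn)
        (g := fun y => ENNReal.ofReal (w y ^ 2))
        (aemeasurable_ofReal_of_continuousOn (hwc.continuousOn.pow 2)) fun y _ => rfl]
    congr 1
    refine withDensity_congr_ae ?_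
    filter_upwards [ae_restrict_mem (measurableSet_extChartAt_target x)] with y hy
    have h0 := hρ₀pos y hy
    rw [Pi.mul_apply, ← ENNReal.ofReal_mul h0.le, hw,
      Real.sq_sqrt (div_pos (hρpos y hy) h0).le, mul_div_cancel₀ _ h0.ne']

theorem isSmoothPosDensity_sqDens [IsManifold I ∞ M] {μ₀ : Measure M}
    (hμ₀ : IsSmoothPosDensity I μ₀) {f : M → ℝ} (hf : ContMDiff I 𝓘(ℝ, ℝ) ∞ f)
    (hpos : ∀ x, 0 < f x) : IsSmoothPosDensity I (sqDens μ₀ f) := by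
  intro x
  obtain ⟨ρ₀, hρ₀, hρ₀pos, hmap₀⟩ := hμ₀ x
  have hfc : ContDiffOn ℝ ∞ (fun y => f ((extChartAt I x).symm y) ^ 2) (extChartAt I x).target := by
    have : ContMDiffOn 𝓘(ℝ, EuclideanSpace ℝ (Fin m)) 𝓘(ℝ, ℝ) ∞
      (f ∘ (extChartAt I x).symm) (extChartAt I x).target :=
      hf.comp_contMDiffOn (contMDiffOn_extChartAt_symm x)
    exact this.contDiffOn.pow 2
  refine ⟨fun y => ρ₀ y * f ((extChartAt I x).symm y) ^ 2, hρ₀.mul hfc,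
    fun y hy => mul_pos (hρ₀pos y hy) (pow_pos (hpos _) 2), ?_⟩
  rw [sqDens, map_restrict_withDensity μ₀ x hmap₀
    (aemeasurable_ofReal_of_continuousOn hρ₀.continuousOn)
    (aemeasurable_ofReal_of_continuousOn hfc.continuousOn)
    fun y hy => by rw [(extChartAt I x).left_inv hy]]
  refine withDensity_congr_ae ?_
  filter_upwards [ae_restrict_mem (measurableSet_extChartAt_target x)] with y hy
  rw [Pi.mul_apply, ENNReal.ofReal_mul (hρ₀pos y hy).le]

theorem ae_eq_of_sqDens_eq {X : Type*} [MeasurableSpace X] {ν : Measure X} [SigmaFinite ν]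
    {f g : X → ℝ}
    (hf : AEMeasurable f ν) (hg : AEMeasurable g ν) (hfp : ∀ᵐ x ∂ν, 0 < f x)
    (hgp : ∀ᵐ x ∂ν, 0 < g x) (h : sqDens ν f = sqDens ν g) : f =ᵐ[ν] g := by
  have := (withDensity_eq_iff_of_sigmaFinite (hf.pow_const 2).ennreal_ofReal
    (hg.pow_const 2).ennreal_ofReal).1 h
  filter_upwards [this, hfp, hgp] with x hx h1 h2
  rw [ENNReal.ofReal_eq_ofReal_iff (sq_nonneg _) (sq_nonneg _)] at hx
  exact (pow_left_inj₀ h1.le h2.le two_ne_zero).1 hx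

/-- On a compact manifold any two smooth positive densities differ by the square of a smooth
positive function: the local square roots agree on overlaps since a continuous density with
respect to a measure of full support is unique. -/
theorem IsSmoothPosDensity.exists_sqDens_eq [IsManifold I ∞ M] [CompactSpace M] {μ μ₀ : Measure M}
    [IsFiniteMeasure μ₀] (hμ : IsSmoothPosDensity I μ) (hμ₀ : IsSmoothPosDensity I μ₀) :
    ∃ f : C^∞⟮I, M; 𝓘(ℝ, ℝ), ℝ⟯, (∀ x, 0 < f x) ∧ sqDens μ₀ f = μ := by
  have := hμ₀.isOpenPosMeasure
  choose r hr hrpos hrμ using hμ.exists_local_sqrt hμ₀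
  have hopen : ∀ x : M, IsOpen (extChartAt I x).source := fun x => isOpen_extChartAt_source x
  -- both `(r x)² μ₀` and `(r y)² μ₀` restrict to `μ` on the overlap of the two chart domains
  have hov : ∀ x y : M, EqOn (r x) (r y) ((extChartAt I x).source ∩ (extChartAt I y).source) := by
    intro x y
    have hO := (hopen x).inter (hopen y)
    have hc1 : ContinuousOn (r x) ((extChartAt I x).source ∩ (extChartAt I y).source) :=
      (hr x).continuousOn.mono inter_subset_left
    have hc2 : ContinuousOn (r y) ((extChartAt I x).source ∩ (extChartAt I y).source) :=
      (hr y).continuousOn.mono inter_subset_right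
    refine Measure.eqOn_open_of_ae_eq (μ := μ₀) ?_ hO hc1 hc2
    refine ae_eq_of_sqDens_eq (hc1.aemeasurable hO.measurableSet)
      (hc2.aemeasurable hO.measurableSet) ?_ ?_ ?_
    · filter_upwards [ae_restrict_mem hO.measurableSet] with z hz using hrpos x z hz.1
    · filter_upwards [ae_restrict_mem hO.measurableSet] with z hz using hrpos y z hz.2
    · have h1 := congrArg (fun ν => ν.restrict (extChartAt I y).source) (hrμ x)
      have h2 := congrArg (fun ν => ν.restrict (extChartAt I x).source) (hrμ y)
      simp only [Measure.restrict_restrict (hopen _).measurableSet] at h1 h2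
      rw [inter_comm] at h1
      rw [h1] at h2
      rwa [sqDens, sqDens, restrict_withDensity hO.measurableSet,
        restrict_withDensity hO.measurableSet] at h2
  have hloc : ∀ x : M, EqOn (fun z => r z z) (r x) (extChartAt I x).source := fun x z hz =>
    hov z x ⟨mem_extChartAt_source z, hz⟩
  refine ⟨⟨fun z => r z z, contMDiff_of_locally_contMDiffOn fun x => ⟨_, hopen x,
    mem_extChartAt_source x, (hr x).congr (hloc x)⟩⟩,
    fun x => hrpos x x (mem_extChartAt_source x), ?_⟩
  obtain ⟨t, ht⟩ := isCompact_univ.elim_finite_subcover (fun x : M => (extChartAt I x).source) hopen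
    fun x _ => mem_iUnion.2 ⟨x, mem_extChartAt_source x⟩
  refine Measure.ext_of_biUnion_eq_univ t.countable_toSet (univ_subset_iff.1 ht) fun x _ => ?_
  rw [hrμ x, sqDens, sqDens, restrict_withDensity (hopen x).measurableSet,
    restrict_withDensity (hopen x).measurableSet]
  refine withDensity_congr_ae ?_
  filter_upwards [ae_restrict_mem (hopen x).measurableSet] with z hz
  exact congrArg (fun a => ENNReal.ofReal (a ^ 2)) (hloc x hz)

theorem integral_sqDens {X : Type*} [MeasurableSpace X] (μ₀ : Measure X) {f : X → ℝ}
    (hf : Measurable f) (k : X → ℝ) :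
    ∫ x, k x ∂sqDens μ₀ f = ∫ x, f x ^ 2 * k x ∂μ₀ := by
  rw [sqDens, integral_withDensity_eq_integral_toReal_smul (hf.pow_const 2).ennreal_ofReal
    (by simp)]
  simp [ENNReal.toReal_ofReal (sq_nonneg _)]

/-- With respect to `f² μ₀`, the density `2 f h μ₀` has the Radon-Nikodym derivative
`2 h / f`. -/
theorem rnDeriv_sqDensTangent [CompactSpace M] {μ₀ : Measure M} [IsFiniteMeasure μ₀] {f h : M → ℝ}
    (hf : Continuous f) (hpos : ∀ x, 0 < f x) (hh : Continuous h) :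
    (sqDensTangent μ₀ f h).rnDeriv (sqDens μ₀ f) =ᵐ[sqDens μ₀ f] fun x => 2 * h x / f x := by
  have hint : ∀ k : M → ℝ, Continuous k → Integrable k μ₀ := fun k hk =>
    hk.integrable_of_hasCompactSupport (HasCompactSupport.of_compactSpace k)
  have hfin : IsFiniteMeasure (sqDens μ₀ f) :=
    isFiniteMeasure_withDensity_ofReal (hint _ (hf.pow 2)).2
  have hint' : Integrable (fun x => 2 * h x / f x) (sqDens μ₀ f) :=
    ((continuous_const.mul hh).div hf fun x => (hpos x).ne').integrable_of_hasCompactSupport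
      (HasCompactSupport.of_compactSpace _)
  refine (SignedMeasure.eq_rnDeriv 0 _ hint' VectorMeasure.MutuallySingular.zero_left ?_).symm
  rw [zero_add]
  ext A hA
  rw [sqDensTangent, withDensityᵥ_apply
      (hint (fun x => 2 * f x * h x) ((continuous_const.mul hf).mul hh)) hA,
    withDensityᵥ_apply hint' hA]
  rw [sqDens, restrict_withDensity hA, ← sqDens, integral_sqDens _ hf.measurable]
  refine integral_congr_ae (.of_forall fun x => ?_)
  have := (hpos x).ne'
  field_simp

/-- The map `f ↦ f² μ₀` pulls back the metric on densities to the square-root metric. -/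
theorem densMetric_sqDens [CompactSpace M] {μ₀ : Measure M} [IsFiniteMeasure μ₀] (C₁ C₂ : ℝ → ℝ)
    {f h k : M → ℝ} (hf : Continuous f) (hpos : ∀ x, 0 < f x) (hh : Continuous h)
    (hk : Continuous k) :
    densMetric C₁ C₂ (sqDens μ₀ f) (sqDensTangent μ₀ f h) (sqDensTangent μ₀ f k) =
      rootMetric C₁ C₂ (fun f g : M → ℝ => ∫ x, f x * g x ∂μ₀) f h k := by
  have hint : ∀ k : M → ℝ, Continuous k → Integrable k μ₀ := fun k hk =>
    hk.integrable_of_hasCompactSupport (HasCompactSupport.of_compactSpace k)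
  have hmass : (sqDens μ₀ f).real univ = ∫ x, f x * f x ∂μ₀ := by
    have := integral_sqDens μ₀ hf.measurable fun _ => 1
    simp only [integral_const, smul_eq_mul, mul_one] at this
    rw [this]
    simp only [sq]
  have htot : ∀ h : M → ℝ, Continuous h →
      sqDensTangent μ₀ f h univ = 2 * ∫ x, f x * h x ∂μ₀ := fun h hh => by
    rw [sqDensTangent, withDensityᵥ_apply
      (hint (fun x => 2 * f x * h x) ((continuous_const.mul hf).mul hh))
      MeasurableSet.univ, Measure.restrict_univ, ← integral_const_mul]
    simp only [mul_assoc]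
  have hprod : ∫ x, (sqDensTangent μ₀ f h).rnDeriv (sqDens μ₀ f) x *
      (sqDensTangent μ₀ f k).rnDeriv (sqDens μ₀ f) x ∂sqDens μ₀ f = 4 * ∫ x, h x * k x ∂μ₀ := by
    refine (integral_congr_ae ((rnDeriv_sqDensTangent hf hpos hh).mul
      (rnDeriv_sqDensTangent hf hpos hk))).trans ?_
    rw [integral_sqDens _ hf.measurable, ← integral_const_mul]
    refine integral_congr_ae (.of_forall fun x => ?_)
    have := (hpos x).ne'
    simp only [Pi.mul_apply]
    field_simp
    ring
  rw [densMetric, rootMetric, hmass, htot h hh, htot k hk, hprod]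
  ring

theorem densitiesEmbed [IsManifold I ∞ M] [CompactSpace M] {μ₀ : Measure M} [IsFiniteMeasure μ₀]
    (hμ₀ : IsSmoothPosDensity I μ₀) (C₁ C₂ : ℝ → ℝ) : DensitiesEmbed I C₁ C₂ μ₀ where
  bijOn := by
    have := hμ₀.isOpenPosMeasure
    refine ⟨fun f hf => isSmoothPosDensity_sqDens hμ₀ f.contMDiff hf, fun f hf g hg hfg => ?_,
      fun μ hμ => ?_⟩
    · have hae := ae_eq_of_sqDens_eq f.contMDiff.continuous.aemeasurable
        g.contMDiff.continuous.aemeasurable (.of_forall hf) (.of_forall hg) hfg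
      exact DFunLike.coe_injective
        ((Continuous.ae_eq_iff_eq μ₀ f.contMDiff.continuous g.contMDiff.continuous).1 hae)
    · obtain ⟨f, hf, hfμ⟩ := IsSmoothPosDensity.exists_sqDens_eq hμ hμ₀
      exact ⟨f, hf, hfμ⟩
  isometry f hf h k := densMetric_sqDens C₁ C₂ f.contMDiff.continuous hf h.contMDiff.continuous
    k.contMDiff.continuous

end Densities

/-! ### Geodesics in the space of smooth functions -/

section Smooth

variable {m : ℕ} {H : Type*} [TopologicalSpace H]
  {I : ModelWithCorners ℝ (EuclideanSpace ℝ (Fin m)) H}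
  {M : Type*} [TopologicalSpace M] [ChartedSpace H M]

/-- The time derivative of a smooth curve of functions is again jointly smooth; smoothness up to
the boundary is checked in charts, where the time derivative is a value of the derivative within
the chart target. -/
theorem contMDiffOn_velocity [IsManifold I ∞ M] {J : Set ℝ} (hJ : IsOpen J) {c v : ℝ → M → ℝ}
    (hc : ContMDiffOn (𝓘(ℝ, ℝ).prod I) 𝓘(ℝ, ℝ) ∞ (fun p : ℝ × M => c p.1 p.2) (J ×ˢ univ))
    (hv : ∀ t ∈ J, ∀ x, HasDerivAt (fun s => c s x) (v t x) t) :
    ContMDiffOn (𝓘(ℝ, ℝ).prod I) 𝓘(ℝ, ℝ) ∞ (fun p : ℝ × M => v p.1 p.2) (J ×ˢ univ) := by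
  refine contMDiffOn_of_locally_contMDiffOn fun p hp => ?_
  set x₀ := p.2
  have hFm : ContMDiffOn (𝓘(ℝ, ℝ).prod 𝓘(ℝ, EuclideanSpace ℝ (Fin m))) 𝓘(ℝ, ℝ) ∞
      (fun q : ℝ × EuclideanSpace ℝ (Fin m) => c q.1 ((extChartAt I x₀).symm q.2))
      (J ×ˢ (extChartAt I x₀).target) := by
    have hsymm : ContMDiffOn (𝓘(ℝ, ℝ).prod 𝓘(ℝ, EuclideanSpace ℝ (Fin m))) I ∞
        (fun q : ℝ × EuclideanSpace ℝ (Fin m) => (extChartAt I x₀).symm q.2)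
        (J ×ˢ (extChartAt I x₀).target) :=
      (contMDiffOn_extChartAt_symm (I := I) (n := ∞) x₀).comp contMDiffOn_snd fun q hq => hq.2
    exact hc.comp (contMDiffOn_fst.prodMk hsymm) fun q hq => ⟨hq.1, mem_univ _⟩
  have hF : ContDiffOn ℝ ∞
      (fun q : ℝ × EuclideanSpace ℝ (Fin m) => c q.1 ((extChartAt I x₀).symm q.2))
      (J ×ˢ (extChartAt I x₀).target) := by
    rw [← contMDiffOn_iff_contDiffOn, modelWithCornersSelf_prod, ← chartedSpaceSelf_prod]
    exact hFm
  have hU : UniqueDiffOn ℝ (J ×ˢ (extChartAt I x₀).target) :=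
    hJ.uniqueDiffOn.prod (uniqueDiffOn_extChartAt_target (I := I) x₀)
  have hw : ContDiffOn ℝ ∞
      (fun q : ℝ × EuclideanSpace ℝ (Fin m) => v q.1 ((extChartAt I x₀).symm q.2))
      (J ×ˢ (extChartAt I x₀).target) := by
    refine ((hF.fderivWithin hU (m := ∞) (by simp)).clm_apply
      (contDiffOn_const (c := ((1, 0) : ℝ × EuclideanSpace ℝ (Fin m))))).congr fun q hq => ?_
    have h1 : HasDerivAt (fun s => c s ((extChartAt I x₀).symm q.2)) _ q.1 := hv q.1 hq.1 _
    have h2 : HasDerivWithinAt (fun s : ℝ => ((s, q.2) : ℝ × EuclideanSpace ℝ (Fin m)))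
        (1, 0) J q.1 :=
      ((hasDerivAt_id q.1).prodMk (hasDerivAt_const q.1 q.2)).hasDerivWithinAt
    have h3 := ((hF.differentiableOn (by simp) q hq).hasFDerivWithinAt).comp_hasDerivWithinAt
      (f := fun s : ℝ => ((s, q.2) : ℝ × EuclideanSpace ℝ (Fin m))) q.1 h2 fun s hs => ⟨hs, hq.2⟩
    exact h1.unique (h3.hasDerivAt (hJ.mem_nhds hq.1))
  refine ⟨univ ×ˢ (extChartAt I x₀).source, isOpen_univ.prod (isOpen_extChartAt_source x₀),
    ⟨mem_univ _, mem_extChartAt_source x₀⟩, ?_⟩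
  have hφ : ContMDiffOn (𝓘(ℝ, ℝ).prod I) 𝓘(ℝ, ℝ × EuclideanSpace ℝ (Fin m)) ∞
      (fun q : ℝ × M => (q.1, extChartAt I x₀ q.2))
      ((J ×ˢ univ) ∩ univ ×ˢ (extChartAt I x₀).source) := by
    refine contMDiffOn_fst.prodMk_space ?_
    refine (contMDiffOn_extChartAt (x := x₀)).comp contMDiffOn_snd fun q hq => ?_
    rw [← extChartAt_source I]
    exact hq.2.2
  refine (hw.contMDiffOn.comp hφ fun q hq =>
    ⟨hq.1.1, (extChartAt I x₀).map_source hq.2.2⟩).congr fun q hq => ?_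
  exact congrArg (v q.1) ((extChartAt I x₀).left_inv hq.2.2).symm

variable [CompactSpace M]

/-- On a compact space, a curve of functions with jointly continuous pointwise velocity is
differentiable uniformly in the space variable. -/
theorem eventually_forall_abs_sub_le {X : Type*} [TopologicalSpace X] [CompactSpace X]
    {J : Set ℝ} (hJ : IsOpen J) {c v : ℝ → X → ℝ}
    (hvc : ContinuousOn (fun p : ℝ × X => v p.1 p.2) (J ×ˢ univ))
    (hv : ∀ t ∈ J, ∀ x, HasDerivAt (fun s => c s x) (v t x) t) {t : ℝ} (ht : t ∈ J) {ε : ℝ}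
    (hε : 0 < ε) : ∀ᶠ s in 𝓝 t, ∀ x, |c s x - c t x - (s - t) * v t x| ≤ ε * |s - t| := by
  have hJX : IsOpen (J ×ˢ (univ : Set X)) := hJ.prod isOpen_univ
  have h1 : ∀ᶠ s in 𝓝 t, ∀ x ∈ (univ : Set X), |v s x - v t x| < ε := by
    refine isCompact_univ.eventually_forall_of_forall_eventually fun x _ => ?_
    have hx : ContinuousAt (fun p : ℝ × X => v p.1 p.2) (t, x) :=
      hvc.continuousAt (hJX.mem_nhds ⟨ht, mem_univ _⟩)
    have hx' : ContinuousAt (fun p : ℝ × X => v t p.2) (t, x) :=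
      ContinuousAt.comp (g := fun p : ℝ × X => v p.1 p.2)
        (f := fun p : ℝ × X => (t, p.2)) (x := (t, x)) hx (by fun_prop)
    have := (hx.sub hx').abs
    exact this.eventually (gt_mem_nhds (by simpa using hε))
  obtain ⟨δ, hδ, hball⟩ := Metric.eventually_nhds_iff_ball.1 (h1.and (hJ.mem_nhds ht))
  filter_upwards [Metric.ball_mem_nhds t hδ] with s hs x
  have := (convex_ball t δ).norm_image_sub_le_of_norm_hasDerivWithin_le
    (f := fun r => c r x - r * v t x) (f' := fun r => v r x - 1 * v t x) (C := ε)
    (fun r hr => ((hv r (hball r hr).2 x).sub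
      ((hasDerivAt_id r).mul_const (v t x))).hasDerivWithinAt)
    (fun r hr => by simpa using ((hball r hr).1 x (mem_univ x)).le)
    (Metric.mem_ball_self hδ) hs
  simp only [Real.norm_eq_abs] at this
  convert this using 2
  ring

variable [MeasurableSpace M] [BorelSpace M]

theorem integrable_mul_smooth (μ₀ : Measure M) [IsFiniteMeasure μ₀]
    (f g : C^∞⟮I, M; 𝓘(ℝ, ℝ), ℝ⟯) : Integrable (fun x => f x * g x) μ₀ :=
  (f.contMDiff.continuous.mul g.contMDiff.continuous).integrable_of_hasCompactSupport
    (HasCompactSupport.of_compactSpace _)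

/-- The `L²(μ₀)` inner product on `C^∞(M, ℝ)`. It is definite since `μ₀` has full support. -/
@[reducible]
noncomputable def smoothInnerCore
    (I : ModelWithCorners ℝ (EuclideanSpace ℝ (Fin m)) H) (μ₀ : Measure M)
    [IsFiniteMeasure μ₀] [μ₀.IsOpenPosMeasure] :
    InnerProductSpace.Core ℝ C^∞⟮I, M; 𝓘(ℝ, ℝ), ℝ⟯ where
  inner f g := ∫ x, f x * g x ∂μ₀
  conj_inner_symm f g := by simp [mul_comm]
  re_inner_nonneg f := integral_nonneg fun x => mul_self_nonneg (f x)
  add_left f g k := by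
    rw [← integral_add (integrable_mul_smooth μ₀ f k) (integrable_mul_smooth μ₀ g k)]
    simp [add_mul]
  smul_left f g r := by
    rw [← integral_const_mul]
    simp [mul_assoc]
  definite f hf := by
    have h0 := (integral_eq_zero_iff_of_nonneg (fun x => mul_self_nonneg (f x))
      (integrable_mul_smooth μ₀ f f)).1 hf
    have hc := f.contMDiff.continuous
    have := (Continuous.ae_eq_iff_eq μ₀ (hc.mul hc) continuous_zero).1 h0
    ext x
    exact mul_self_eq_zero.1 (congrFun this x)

/-- Joint smoothness and pointwise velocity give differentiability in the `L²(μ₀)` norm. -/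
theorem hasDerivAt_smooth [IsManifold I ∞ M] (μ₀ : Measure M) [IsProbabilityMeasure μ₀]
    [μ₀.IsOpenPosMeasure] {J : Set ℝ} (hJ : IsOpen J)
    {c v : ℝ → C^∞⟮I, M; 𝓘(ℝ, ℝ), ℝ⟯}
    (hvc : ContMDiffOn (𝓘(ℝ, ℝ).prod I) 𝓘(ℝ, ℝ) ∞ (fun p : ℝ × M => v p.1 p.2) (J ×ˢ univ))
    (hv : ∀ t ∈ J, HasVelocity I c (v t) t) {t : ℝ} (ht : t ∈ J) :
    letI := (smoothInnerCore I μ₀).toNormedAddCommGroup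
    letI : InnerProductSpace ℝ C^∞⟮I, M; 𝓘(ℝ, ℝ), ℝ⟯ := .ofCore (smoothInnerCore I μ₀).toCore
    HasDerivAt c (v t) t := by
  let _ := (smoothInnerCore I μ₀).toNormedAddCommGroup
  let _ : InnerProductSpace ℝ C^∞⟮I, M; 𝓘(ℝ, ℝ), ℝ⟯ := .ofCore (smoothInnerCore I μ₀).toCore
  have hnorm : ∀ (f : C^∞⟮I, M; 𝓘(ℝ, ℝ), ℝ⟯) (B : ℝ), 0 ≤ B → (∀ x, |f x| ≤ B) → ‖f‖ ≤ B := by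
    intro f B hB hf
    refine (sq_le_sq₀ (norm_nonneg f) hB).1 ?_
    have hsq : ‖f‖ ^ 2 = ∫ x, f x * f x ∂μ₀ := (real_inner_self_eq_norm_sq f).symm
    calc ‖f‖ ^ 2 = ∫ x, f x * f x ∂μ₀ := hsq
      _ ≤ ∫ _, B ^ 2 ∂μ₀ := integral_mono (integrable_mul_smooth μ₀ f f) (integrable_const _)
          fun x => by
            have := sq_le_sq' (abs_le.1 (hf x)).1 (abs_le.1 (hf x)).2
            simpa [sq] using this
      _ = B ^ 2 := by simp
  rw [hasDerivAt_iff_isLittleO, Asymptotics.isLittleO_iff]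
  intro ε hε
  filter_upwards [eventually_forall_abs_sub_le (c := fun t x => c t x) (v := fun t x => v t x)
    hJ hvc.continuousOn hv ht hε] with s hs
  exact hnorm _ _ (mul_nonneg hε.le (abs_nonneg _)) hs

theorem smoothGeodesicallyComplete [IsManifold I ∞ M] {C₁ C₂ : ℝ → ℝ}
    (h : IsCompleteAdmissible C₁ C₂) (μ₀ : Measure M) [IsProbabilityMeasure μ₀]
    [μ₀.IsOpenPosMeasure] : SmoothGeodesicallyComplete I (rootMetricSmooth I C₁ C₂ μ₀) := by
  let _ := (smoothInnerCore I μ₀).toNormedAddCommGroup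
  let _ : InnerProductSpace ℝ C^∞⟮I, M; 𝓘(ℝ, ℝ), ℝ⟯ := .ofCore (smoothInnerCore I μ₀).toCore
  have hmetric : rootMetricSmooth I C₁ C₂ μ₀ = innerMetric C₁ C₂ := rfl
  -- The geodesics of the inner product space stay in a finite-dimensional space of smooth
  -- functions, so they are jointly smooth and their norm derivatives are pointwise velocities.
  have key : ∀ f k : C^∞⟮I, M; 𝓘(ℝ, ℝ), ℝ⟯, f ≠ 0 → ∀ t₀ : ℝ,
      ∃ c v : ℝ → C^∞⟮I, M; 𝓘(ℝ, ℝ), ℝ⟯,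
        IsSmoothGeodesicOn I (rootMetricSmooth I C₁ C₂ μ₀) univ c ∧ c t₀ = f ∧ v t₀ = k ∧
        ∀ t, HasVelocity I c (v t) t ∧ HasDerivAt c (v t) t ∧
          HasDerivAt v (geodesicAcc C₁ C₂ (c t) (v t)) t := by
    intro f k hf t₀
    obtain ⟨V, _, c, v, b, ⟨hcs, hc0, hv0⟩, hc⟩ := h.exists_geodesic hf k t₀
    let eval : M → V →ₗ[ℝ] ℝ := fun x =>
      { toFun := fun g => (g : C^∞⟮I, M; 𝓘(ℝ, ℝ), ℝ⟯) x
        map_add' := fun _ _ => rfl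
        map_smul' := fun _ _ => rfl }
    have hvel : ∀ (c : ℝ → V) (v : V) (t : ℝ), HasDerivAt c v t →
        HasVelocity I (fun t => (c t : C^∞⟮I, M; 𝓘(ℝ, ℝ), ℝ⟯)) v t := by
      intro c v t hcv x
      exact (LinearMap.toContinuousLinearMap (eval x)).hasFDerivAt.comp_hasDerivAt t hcv
    have hd : ∀ (c : ℝ → V) (v : V) (t : ℝ), HasDerivAt c v t →
        HasDerivAt (fun t => (c t : C^∞⟮I, M; 𝓘(ℝ, ℝ), ℝ⟯)) v t := fun c v t hcv =>
      V.subtypeL.hasFDerivAt.comp_hasDerivAt t hcv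
    refine ⟨fun t => c t, fun t => v t, ⟨?_, fun t _ => (hc t).1,
      fun t => v t, fun t => b t, fun t _ => ⟨hvel c _ t (hc t).2.1, hvel v _ t (hc t).2.2.1, ?_⟩⟩,
      hc0, hv0, fun t => ⟨hvel c _ t (hc t).2.1, hd c _ t (hc t).2.1, ?_⟩⟩
    · let B := Module.finBasis ℝ V
      have hcoord : ∀ i, ContDiff ℝ ∞ fun t => B.repr (c t) i := fun i =>
        (LinearMap.toContinuousLinearMap (B.coord i)).contDiff.comp hcs
      have hexp : (fun p : ℝ × M => (c p.1 : C^∞⟮I, M; 𝓘(ℝ, ℝ), ℝ⟯) p.2) =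
          fun p => ∑ i, B.repr (c p.1) i * (B i : C^∞⟮I, M; 𝓘(ℝ, ℝ), ℝ⟯) p.2 := by
        funext p
        have := congrArg (eval p.2) (B.sum_repr (c p.1)).symm
        rw [map_sum] at this
        simpa [eval] using this
      rw [hexp]
      refine ContMDiff.contMDiffOn (contMDiff_finsetSum fun i _ => ?_)
      exact ((hcoord i).contMDiff.comp contMDiff_fst).mul
        ((B i : C^∞⟮I, M; 𝓘(ℝ, ℝ), ℝ⟯).contMDiff.comp contMDiff_snd)
    · rw [hmetric, h.geodesicEquation_iff (hc t).1]
      exact (hc t).2.2.2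
    · rw [← (hc t).2.2.2]
      exact hd v _ t (hc t).2.2.1
  refine ⟨fun f k hf => ?_, fun J c hJ hJc hJn hc => ?_⟩
  · obtain ⟨c, v, hc, hc0, hv0, hcv⟩ := key f k hf 0
    exact ⟨c, hc, hc0, hv0 ▸ (hcv 0).1⟩
  · obtain ⟨t₀, ht₀⟩ := hJn
    obtain ⟨v, b, hvb⟩ := hc.equation
    obtain ⟨c', v', hc', h0, h1, hcv⟩ := key (c t₀) (v t₀) (hc.ne_zero t₀ ht₀) t₀
    have hvs := contMDiffOn_velocity hJ (c := fun t x => c t x) (v := fun t x => v t x) hc.smooth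
      fun t ht => (hvb t ht).1
    have hbs := contMDiffOn_velocity hJ (c := fun t x => v t x) (v := fun t x => b t x) hvs
      fun t ht => (hvb t ht).2.1
    refine ⟨c', hc', h.geodesic_unique hJ hJc (fun t _ => ⟨hc'.ne_zero t trivial, (hcv t).2⟩)
      (fun t ht => ⟨hc.ne_zero t ht, ?_, ?_⟩) ht₀ h0 h1⟩
    · exact hasDerivAt_smooth μ₀ hJ hvs (fun t ht => (hvb t ht).1) ht
    · rw [← (h.geodesicEquation_iff (hc.ne_zero t ht) _ _).1 (hvb t ht).2.2]
      exact hasDerivAt_smooth μ₀ hJ hbs (fun t ht => (hvb t ht).2.1) ht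

end Smooth

end DensMetric

theorem mainTheorem2 {m : ℕ} {H : Type*} [TopologicalSpace H]
    (I : ModelWithCorners ℝ (EuclideanSpace ℝ (Fin m)) H)
    {M : Type*} [TopologicalSpace M] [ChartedSpace H M] [IsManifold I ∞ M]
    [CompactSpace M] [T2Space M] [MeasurableSpace M] [BorelSpace M]
    (μ₀ : MeasureTheory.Measure M) [MeasureTheory.IsProbabilityMeasure μ₀]
    (hμ₀ : DensMetric.IsSmoothPosDensity I μ₀)
    (C₁ C₂ : ℝ → ℝ)
    (hC₁ : ContDiffOn ℝ ∞ C₁ (Set.Ioi 0)) (hC₂ : ContDiffOn ℝ ∞ C₂ (Set.Ioi 0))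
    (hC₁_pos : ∀ l : ℝ, 0 < l → 0 < C₁ l)
    (hC₂_gt : ∀ l : ℝ, 0 < l → -(1 / l) * C₁ l < C₂ l)
    (hW_minus : Filter.Tendsto (DensMetric.W C₁ C₂) (𝓝[>] 0) Filter.atBot)
    (hW_plus : Filter.Tendsto (DensMetric.W C₁ C₂) Filter.atTop Filter.atTop) :
    DensMetric.MetricallyComplete (DensMetric.rootMetricL2 C₁ C₂ μ₀) ∧
    DensMetric.GeodesicallyComplete (DensMetric.rootMetricL2 C₁ C₂ μ₀) ∧
    DensMetric.SmoothGeodesicallyComplete I (DensMetric.rootMetricSmooth I C₁ C₂ μ₀) ∧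
    DensMetric.PolarIsometricDiffeo C₁ C₂ (DensMetric.rootMetricL2 C₁ C₂ μ₀) ∧
    DensMetric.DensitiesEmbed I C₁ C₂ μ₀ := by
  have h : DensMetric.IsCompleteAdmissible C₁ C₂ :=
    ⟨⟨hC₁, hC₂, hC₁_pos, hC₂_gt⟩, hW_minus, hW_plus⟩
  have := hμ₀.isOpenPosMeasure
  exact ⟨h.metricallyComplete, h.geodesicallyComplete, DensMetric.smoothGeodesicallyComplete h μ₀,
    h.polarIsometricDiffeo, DensMetric.densitiesEmbed hμ₀ C₁ C₂⟩
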